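/- There exist absolute constants $c,C\in(0,\infty)$ such that the following holds. Let $P^1=(p^1(x,y))$ and $P^2=(p^2(x,y))$ be irreducible transition matrices on a common finite state space $\Sigma$ with the same invariant distribution $\pi$, and suppose that their mixing times $$T^i=\min\Big\{n\ge 0:\ \max_{x\in\Sigma}\tfrac12\sum_{y\in\Sigma}\big|(P^i)^n(x,y)-\pi(y)\big|\le \tfrac14\Big\},\qquad i=1,2,$$ are finite. Let $\nu^1,\nu^2$ be probability distributions on $\Sigma$ and let $\mu$ be a measure on $\Sigma$ with $0<\mu(x)<\infty$ for all $x$. Put $\pi_\star=\min_z\pi(z)$, $g(z)=\pi(z)/\mu(z)$, $\rho^i_z(x)=p^i(x,z)/\mu(z)$, $\pi(f)=\sum_x\pi(x)f(x)$, $\mathrm{Var}_\pi f=\pi\big((f-\pi(f))^2\big)$, $\|f\|_\infty=\max_x|f(x)|$ and $$k(\varepsilon)=-\min_{i=1,2}\min_{z\in\Sigma}\log_2\frac{\pi_\star\,\varepsilon^2 g(z)^2}{6\,\mathrm{Var}_\pi\rho^i_z}.$$ Then there is a probability space $(\Omega,\mathcal F,\mathbb Q)$ carrying Markov chains $Z^1=(Z^1_j)_{j\ge1}$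 and $Z^2=(Z^2_j)_{j\ge1}$ with transition matrices $P^1$, $P^2$ and starting distributions $\nu^1$, $\nu^2$ (that is, $Z^i_1\sim\nu^i$), such that for every $\varepsilon$ with $$0<\varepsilon\le\frac12\wedge\min_{i=1,2}\min_{z\in\Sigma}\frac{\mathrm{Var}_\pi\rho^i_z}{2\|\rho^i_z\|_\infty\, g(z)}$$ and every integer $n\ge 2k(\varepsilon)(T^1\vee T^2)$, the event $$\mathcal G(n,\varepsilon)=\Big\{\{Z^1_j\}_{1\le j\le n(1-\varepsilon)}\subset\{Z^2_j\}_{1\le j\le n}\subset\{Z^1_j\}_{1\le j\le n(1+\varepsilon)}\Big\}$$ satisfies $$\mathbb Q\big[\mathcal G(n,\varepsilon)^c\big]\le C\sum_{i=1,2}\ \sum_{z\in\Sigma}\Big(e^{-cn\varepsilon^2}+e^{-cn\varepsilon\,\pi(z)/\nu^i(z)}+\exp\Big\{-\frac{c\,\varepsilon^2g(z)^2}{\mathrm{Var}_\pi\rho^i_z}\cdot\frac{n}{k(\varepsilon)\,T^i}\Big\}\Big),$$ where $e^{-cn\varepsilon\,\pi(z)/\nu^i(z)}$ is read as $0$ if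 $\nu^i(z)=0$. -/

import Mathlib

open MeasureTheory

noncomputable section

namespace RangeCoupling

variable {S : Type*}

/-- Total variation distance `(1/2) ∑ₓ |ν(x) - ν'(x)|` on a finite set. -/
def tvDist [Fintype S] (ν ν' : S → ℝ) : ℝ := (1 / 2) * ∑ x, |ν x - ν' x|

/-- `T` is the mixing time of the chain with transition matrix `P` and invariant law `π`:
the least `n ≥ 0` with `max_x ‖Pⁿ(x, ·) - π‖_TV ≤ 1/4`. In particular such an `n` exists
(for an irreducible chain, this means that the chain is aperiodic). -/
def IsMixingTime [Fintype S] [DecidableEq S] (P : Matrix S S ℝ) (π : S → ℝ) (T : ℕ) : Prop :=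
  IsLeast {n : ℕ | ∀ x, tvDist ((P ^ n) x) π ≤ 1 / 4} T

/-- `π(f) = ∑ₓ π(x) f(x)`. -/
def mean [Fintype S] (π f : S → ℝ) : ℝ := ∑ x, π x * f x

/-- `Var_π f = π((f - π(f))²)`. -/
def var [Fintype S] (π f : S → ℝ) : ℝ := mean π (fun x => (f x - mean π f) ^ 2)

/-- `π_⋆ = min_z π(z)`. -/
def piMin [Fintype S] (π : S → ℝ) : ℝ := ⨅ z, π z

/-- The density `g(x) = π(x) / μ(x)` of `π` with respect to `μ`. -/
def statDensity (π μ : S → ℝ) (x : S) : ℝ := π x / μ x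

/-- The arrival density `ρ_y : x ↦ p(x, y) / μ(y)`. Its sup norm `‖ρ_y‖_∞` is the norm of
the function space `S → ℝ`. -/
def arrivalDensity (P : Matrix S S ℝ) (μ : S → ℝ) (y : S) : S → ℝ := fun x => P x y / μ y

/-- `k(ε) = - min_i min_z log₂ (π_⋆ ε² g(z)² / (6 Var_π ρⁱ_z))`. -/
def kFun [Fintype S] (P : Fin 2 → Matrix S S ℝ) (π μ : S → ℝ) (ε : ℝ) : ℝ :=
  -⨅ i, ⨅ z, Real.logb 2
    (piMin π * ε ^ 2 * statDensity π μ z ^ 2 / (6 * var π (arrivalDensity (P i) μ z)))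

/-- `exp(-a p / q)` with the convention `p / 0 = ∞`, so that the value is `0` for `q = 0`. -/
def expNegRatio (a p q : ℝ) : ℝ :=
  open Classical in if q = 0 then 0 else Real.exp (-(a * (p / q)))

/-- `(Z_i)_{i ≥ 1}` is, under `Q`, a Markov chain on the finite set `S` with transition
matrix `P` whose starting distribution (the law of its first state `Z_1`) is `ν`: the `Z_i`
are random variables with
`Q[Z_1 = x_0, …, Z_{m+1} = x_m] = ν(x_0) p(x_0, x_1) ⋯ p(x_{m-1}, x_m)`.
The value `Z 0` plays no role. -/
structure IsMarkovChain {Ω : Type*} [MeasurableSpace Ω] (Q : Measure Ω)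
    (P : Matrix S S ℝ) (ν : S → ℝ) (Z : ℕ → Ω → S) : Prop where
  measurableSet_eq : ∀ i, 1 ≤ i → ∀ x, MeasurableSet {ω | Z i ω = x}
  law : ∀ (m : ℕ) (x : ℕ → S),
    Q.real {ω | ∀ j ≤ m, Z (j + 1) ω = x j} =
      ν (x 0) * ∏ j ∈ Finset.range m, P (x j) (x (j + 1))

/-- The range `{Z_i}_{i=1}^t` up to the real time `t`, i.e. over integers `1 ≤ i ≤ t`. -/
def visited {Ω : Type*} (Z : ℕ → Ω → S) (t : ℝ) (ω : Ω) : Set S :=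
  {x | ∃ i : ℕ, 1 ≤ i ∧ (i : ℝ) ≤ t ∧ Z i ω = x}

/-- The good event
`{Z¹_i}_{i=1}^{n(1-ε)} ⊆ {Z²_i}_{i=1}^n ⊆ {Z¹_i}_{i=1}^{n(1+ε)}`. -/
def goodEvent {Ω : Type*} (Z : Fin 2 → ℕ → Ω → S) (n : ℕ) (ε : ℝ) : Set Ω :=
  {ω | visited (Z 0) (n * (1 - ε)) ω ⊆ visited (Z 1) n ω ∧
    visited (Z 1) n ω ⊆ visited (Z 0) (n * (1 + ε)) ω}

end RangeCoupling

end

/-!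
The coupling uses soft local times. Give the chain `x₀, x₁, …` independent standard exponential
waiting times `ξ₀, ξ₁, …`, and let `G_m(z) = ∑_{k < m} ξ_k p(x_{k-1}, z)` (with `ν(z)` in place of
`p(x_{-1}, z)`) be the soft local time at `z`. Let `U_z` be the value of `G(z)` at the step in which
the chain first visits `z`. Then `z` has been visited in the first `m` steps when `U_z < G_m(z)`
and only when `U_z ≤ G_m(z)`, so that the range is read off from `U` and the soft local times alone.

The point is that the `U_z` are independent standard exponential variables, whatever the chain
(`integral_cexp_hitLevel`, `map_hitLevel_eq`). Indeed the conditional characteristic function of `U`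
given the first `n` states, a product of `1 / (1 - i t_z)` over the unvisited states and of one
factor for each past step, has a mean that does not depend on `n`: the sum over the next state is
cancelled by the Fourier transform of the waiting time (`integral_condCharFun_succ`). Since `U` has
the same law for both chains, `exists_coupling_of_map_eq` glues them so that they share `U`. On the
glued space the inclusions of ranges follow from
`G¹_{n(1-ε)} < G²_n < G¹_{n(1+ε)}` at every `z` (`exists_visit_of_softTime_lt`), and
this concerns each chain separately, whence a single coupling serves all `n` and `ε`. The reference
measure `μ` only rescales the soft local times and cancels.

It remains to show that `G_m(z)` is within `(3/8) ε n π(z)` of `m π(z)` (`measure_softTime_le`).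
The difference consists of the first step `ξ₀ ν(z)`, of `π(z) ∑ (ξ_k - 1)`, and of
`∑ ξ_{k+1} h(x_k)` with `h = p(·, z) - π(z)`; these give the three exponentials of the bound. For
the last sum, the times are split into residue classes modulo `L = 4 ⌈k(ε)⌉ T`. Within a class the
states are independent with law `π` up to a factor `1 + δ`, because the distance to `π` halves over
each mixing time (`sum_abs_pow_sub_le`), and Chernoff's bound applies to each class
(`measure_le_sum_le`); the choice of `k(ε)` makes `δ` small against `ε² π(z)² / Var`.
-/

namespace RangeCoupling
open ProbabilityTheory Finset
open scoped ENNReal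

/-! ### Exponential waiting times -/

section

instance : IsProbabilityMeasure (expMeasure 1) := isProbabilityMeasure_expMeasure one_pos

lemma expMeasure_one_eq :
    expMeasure 1 = (volume.restrict (Set.Ioi 0)).withDensity
      (fun x => ENNReal.ofReal (Real.exp (-x))) := by
  have h : expMeasure 1 = volume.withDensity (exponentialPDF 1) := rfl
  have h2 : exponentialPDF 1 =
      (Set.Ici 0).indicator (fun x => ENNReal.ofReal (Real.exp (-x))) := by
    ext x
    by_cases hx : 0 ≤ x <;> simp [exponentialPDF_eq, hx]
  rw [h, h2, withDensity_indicator measurableSet_Ici,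
    Measure.restrict_congr_set Ioi_ae_eq_Ici]

lemma ae_pos_expMeasure : ∀ᵐ x ∂(expMeasure 1), 0 < x := by
  rw [expMeasure_one_eq]
  exact (withDensity_absolutelyContinuous _ _).ae_le (ae_restrict_mem measurableSet_Ioi)

lemma integral_cexp_expMeasure {c : ℂ} (hc : c.re < 1) :
    ∫ x, Complex.exp (c * x) ∂(expMeasure 1) = (1 - c)⁻¹ := by
  have hc' : (c - 1).re < 0 := by simpa using hc
  have hne : 1 - c ≠ 0 := fun h => by
    have : c = 1 := (sub_eq_zero.mp h).symm
    simp [this] at hc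
  rw [expMeasure_one_eq, integral_withDensity_eq_integral_toReal_smul (by fun_prop)
    (by simp)]
  have : ∀ x : ℝ, (ENNReal.ofReal (Real.exp (-x))).toReal • Complex.exp (c * x) =
      Complex.exp ((c - 1) * x) := by
    intro x
    rw [ENNReal.toReal_ofReal (Real.exp_pos _).le, Complex.real_smul, Complex.ofReal_exp,
      ← Complex.exp_add]
    congr 1
    push_cast
    ring
  simp_rw [this]
  rw [integral_exp_mul_complex_Ioi hc']
  have : c - 1 ≠ 0 := fun h => hne (by linear_combination -h)
  simp
  field_simp
  ring

lemma lintegral_exp_expMeasure {c : ℝ} (hc : c < 1) :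
    ∫⁻ x, ENNReal.ofReal (Real.exp (c * x)) ∂(expMeasure 1) = ENNReal.ofReal (1 - c)⁻¹ := by
  have hc' : c - 1 < 0 := by linarith
  rw [expMeasure_one_eq, lintegral_withDensity_eq_lintegral_mul _ (by fun_prop) (by fun_prop)]
  have : ∀ x : ℝ, ((fun x : ℝ => ENNReal.ofReal (Real.exp (-x))) *
      fun x => ENNReal.ofReal (Real.exp (c * x))) x = ENNReal.ofReal (Real.exp ((c - 1) * x)) := by
    intro x
    rw [Pi.mul_apply, ← ENNReal.ofReal_mul (Real.exp_pos _).le, ← Real.exp_add]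
    congr 2
    ring
  simp_rw [this]
  rw [← ofReal_integral_eq_lintegral_ofReal (integrableOn_exp_mul_Ioi hc' 0)
    (ae_of_all _ fun x => (Real.exp_pos _).le), integral_exp_mul_Ioi hc']
  congr 1
  have : 1 - c ≠ 0 := by linarith
  have : c - 1 ≠ 0 := by linarith
  simp
  field_simp
  ring

/-- The law of a sequence `ξ₀, ξ₁, …` of independent standard exponential variables. -/
noncomputable def waitingLaw : Measure (ℕ → ℝ) := Measure.infinitePi fun _ => expMeasure 1

instance : IsProbabilityMeasure waitingLaw := by unfold waitingLaw; infer_instance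

lemma ae_pos_waitingLaw : ∀ᵐ ξ ∂waitingLaw, ∀ k, 0 < ξ k := by
  rw [ae_all_iff]
  intro k
  exact (measurePreserving_eval_infinitePi (fun _ : ℕ => expMeasure 1) k).quasiMeasurePreserving.ae
    ae_pos_expMeasure

lemma integral_cexp_waitingLaw (n : ℕ) (c : ℕ → ℂ) (hc : ∀ k, (c k).re < 1) :
    ∫ ξ, Complex.exp (∑ k ∈ range n, c k * ξ k) ∂waitingLaw = ∏ k ∈ range n, (1 - c k)⁻¹ := by
  have h := integral_restrict_infinitePi (μ := fun _ : ℕ => expMeasure 1) (s := range n)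
    (f := fun y => ∏ k : range n, Complex.exp (c k * y k))
    (Measurable.aestronglyMeasurable (by fun_prop))
  rw [integral_fintype_prod_eq_prod (f := fun (k : range n) (x : ℝ) => Complex.exp (c k * x))] at h
  simp_rw [integral_cexp_expMeasure (hc _)] at h
  rw [prod_coe_sort (range n) (fun k => (1 - c k)⁻¹)] at h
  rw [← h]
  refine integral_congr_ae (ae_of_all _ fun ξ => ?_)
  simp only [Complex.exp_sum, Finset.restrict]
  exact (prod_coe_sort (range n) (fun k => Complex.exp (c k * ξ k))).symm

lemma lintegral_exp_waitingLaw (n : ℕ) (c : ℕ → ℝ) (hc : ∀ k, c k < 1) {e : ℕ → ℕ}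
    (he : e.Injective) :
    ∫⁻ ξ, ENNReal.ofReal (Real.exp (∑ k ∈ range n, c k * ξ (e k))) ∂waitingLaw =
      ENNReal.ofReal (∏ k ∈ range n, (1 - c k)⁻¹) := by
  have hind : iIndepFun (fun k (ξ : ℕ → ℝ) => ξ (e k)) waitingLaw :=
    (iIndepFun_infinitePi (P := fun _ : ℕ => expMeasure 1) (X := fun _ x => x)
      (by fun_prop)).precomp he
  have h := lintegral_prod_eq_prod_lintegral_of_indepFun (range n)
    (fun k (ξ : ℕ → ℝ) => ENNReal.ofReal (Real.exp (c k * ξ (e k))))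
    (hind.comp (fun k x => ENNReal.ofReal (Real.exp (c k * x))) (by fun_prop)) (by fun_prop)
  have h2 : ∀ k, ∫⁻ ξ, ENNReal.ofReal (Real.exp (c k * ξ (e k))) ∂waitingLaw =
      ENNReal.ofReal (1 - c k)⁻¹ := by
    intro k
    rw [← lintegral_exp_expMeasure (hc k)]
    exact (measurePreserving_eval_infinitePi (fun _ : ℕ => expMeasure 1) (e k)).lintegral_comp
      (f := fun x => ENNReal.ofReal (Real.exp (c k * x))) (by fun_prop)
  simp_rw [h2] at h
  rw [ENNReal.ofReal_prod_of_nonneg fun k _ => inv_nonneg.2 (by linarith [hc k]), ← h]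
  refine lintegral_congr fun ξ => ?_
  rw [Real.exp_sum, ENNReal.ofReal_prod_of_nonneg fun k _ => (Real.exp_pos _).le]

end

/-! ### The law of the chain on path space -/

section

variable {S : Type*}

/-- The conditional probability that the path `x` is at `w` at time `k`, given its states before
time `k`: the starting law `ν` for `k = 0`, and the row `P (x (k - 1))` afterwards. -/
def stepProb (P : Matrix S S ℝ) (ν : S → ℝ) : ℕ → (ℕ → S) → S → ℝ
  | 0, _, w => ν w
  | k + 1, x, w => P (x k) w

/-- `M` is the law, on the space of paths `ℕ → S`, of the Markov chain with transition matrix `P`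
and starting law `ν`. Here time starts at `0`. -/
structure IsPathLaw [MeasurableSpace S] (P : Matrix S S ℝ) (ν : S → ℝ)
    (M : Measure (ℕ → S)) : Prop where
  isProb : IsProbabilityMeasure M
  cylinder : ∀ (n : ℕ) (x : ℕ → S),
    M.real {z | ∀ j < n, z j = x j} = ∏ j ∈ range n, stepProb P ν j x (x j)

/-- The path driven by `W`: the state at time `k` is read off from the entry of `W` at `k` and the
previous state, which is `none` for `k = 0`. -/
def drivenPath (W : ℕ × Option S → S) : ℕ → S
  | 0 => W (0, none)
  | k + 1 => W (k + 1, some (drivenPath W k))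

/-- The state before time `k`, with `none` for `k = 0`. -/
def prevState (x : ℕ → S) : ℕ → Option S
  | 0 => none
  | k + 1 => some (x k)

lemma drivenPath_eq (W : ℕ × Option S → S) (k : ℕ) :
    drivenPath W k = W (k, prevState (drivenPath W) k) := by
  cases k <;> rfl

lemma drivenPath_eq_on_iff (W : ℕ × Option S → S) (x : ℕ → S) (n : ℕ) :
    (∀ j < n, drivenPath W j = x j) ↔ ∀ j < n, W (j, prevState x j) = x j := by
  induction n with
  | zero => simp
  | succ n ih =>
    have key : ∀ p : ℕ → Prop, (∀ j < n + 1, p j) ↔ (∀ j < n, p j) ∧ p n := by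
      intro p
      exact Nat.forall_lt_succ_right
    rw [key, key, ih]
    refine and_congr_right fun h => ?_
    have h' := ih.2 h
    rw [drivenPath_eq]
    cases n with
    | zero => rfl
    | succ m => simp only [prevState, h' m (Nat.lt_succ_self m)]

variable [Fintype S] [MeasurableSpace S] [DiscreteMeasurableSpace S]

lemma measurable_drivenPath : Measurable (drivenPath : (ℕ × Option S → S) → ℕ → S) := by
  rw [measurable_pi_iff]
  intro k
  induction k with
  | zero => exact measurable_pi_apply _
  | succ k ih =>
    refine measurable_to_countable' fun w => ?_
    have : (fun W : ℕ × Option S → S => drivenPath W (k + 1)) ⁻¹' {w} =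
        ⋃ s : S, (fun W => drivenPath W k) ⁻¹' {s} ∩ (fun W => W (k + 1, some s)) ⁻¹' {w} := by
      ext W
      simp [drivenPath]
    rw [this]
    exact MeasurableSet.iUnion fun s => (ih (measurableSet_singleton s)).inter
      (measurable_pi_apply (k + 1, some s) (measurableSet_singleton w))

theorem exists_isPathLaw [DecidableEq S] {P : Matrix S S ℝ} (hP : P ∈ Matrix.rowStochastic ℝ S)
    {ν : S → ℝ} (hν : ν ∈ stdSimplex ℝ S) : ∃ M : Measure (ℕ → S), IsPathLaw P ν M := by
  let row : Option S → S → ℝ := fun s => s.elim ν P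
  have hrow : ∀ s, row s ∈ stdSimplex ℝ S := by
    rintro (_ | s)
    · exact hν
    · exact ⟨fun w => hP.1 s w, Matrix.sum_row_of_mem_rowStochastic hP s⟩
  let κ : Option S → Measure S := fun s => ∑ w, ENNReal.ofReal (row s w) • Measure.dirac w
  have hκ : ∀ s w, κ s {w} = ENNReal.ofReal (row s w) := by
    intro s w
    simp only [κ, Measure.coe_finsetSum, Measure.coe_smul, Finset.sum_apply, Pi.smul_apply,
      smul_eq_mul]
    rw [Finset.sum_eq_single w]
    · simp
    · intro b _ hb
      simp [hb]
    · simp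
  have : ∀ s, IsProbabilityMeasure (κ s) := by
    intro s
    refine ⟨?_⟩
    simp only [κ, Measure.coe_finsetSum, Measure.coe_smul, Finset.sum_apply, Pi.smul_apply,
      smul_eq_mul, measure_univ, mul_one]
    rw [← ENNReal.ofReal_sum_of_nonneg fun w _ => (hrow s).1 w, (hrow s).2, ENNReal.ofReal_one]
  let D : Measure (ℕ × Option S → S) := Measure.infinitePi fun p => κ p.2
  have hm := measurable_drivenPath (S := S)
  refine ⟨D.map drivenPath, Measure.isProbabilityMeasure_map hm.aemeasurable, fun n x => ?_⟩
  have hset : MeasurableSet {z : ℕ → S | ∀ j < n, z j = x j} := by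
    have : {z : ℕ → S | ∀ j < n, z j = x j} =
        ⋂ j, ⋂ _ : j < n, (fun z : ℕ → S => z j) ⁻¹' {x j} := by
      ext; simp
    rw [this]
    exact MeasurableSet.iInter fun j => MeasurableSet.iInter fun _ =>
      measurable_pi_apply j (measurableSet_singleton (x j))
  rw [measureReal_def, Measure.map_apply hm hset]
  let e : ℕ ↪ ℕ × Option S := 
    ⟨fun j => (j, prevState x j), fun i j h => congrArg Prod.fst h⟩
  have hpre : drivenPath ⁻¹' {z : ℕ → S | ∀ j < n, z j = x j} =
      Set.pi ((range n).map e) fun p => {x p.1} := by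
    ext W
    simp only [Set.mem_preimage, Set.mem_ofPred_eq, drivenPath_eq_on_iff]
    simp only [e, Set.mem_pi, coe_map, Set.mem_image, mem_coe, mem_range, forall_exists_index,
      and_imp, forall_apply_eq_imp_iff₂]
    exact Iff.rfl
  rw [hpre, Measure.infinitePi_pi _ fun p _ => measurableSet_singleton _, prod_map,
    ENNReal.toReal_prod]
  refine prod_congr rfl fun j _ => ?_
  simp only [hκ]
  rw [ENNReal.toReal_ofReal ((hrow _).1 _)]
  cases j <;> rfl

end

/-! ### The Markov property for functionals of finitely many states -/

section

variable {S : Type*}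

lemma stepProb_congr (P : Matrix S S ℝ) (ν : S → ℝ) {k : ℕ} {x y : ℕ → S}
    (h : ∀ j < k, x j = y j) (w : S) : stepProb P ν k x w = stepProb P ν k y w := by
  cases k with
  | zero => rfl
  | succ k => simp only [stepProb, h k (Nat.lt_succ_self k)]

lemma stepProb_mem_stdSimplex [Fintype S] [DecidableEq S] {P : Matrix S S ℝ}
    (hP : P ∈ Matrix.rowStochastic ℝ S) {ν : S → ℝ} (hν : ν ∈ stdSimplex ℝ S) (k : ℕ)
    (x : ℕ → S) : stepProb P ν k x ∈ stdSimplex ℝ S := by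
  cases k with
  | zero => exact hν
  | succ k => exact ⟨fun w => hP.1 _ w, Matrix.sum_row_of_mem_rowStochastic hP _⟩

/-- The path that follows `x` for `n` steps and the path `x₀` afterwards. -/
def extendPath (x₀ : ℕ → S) {n : ℕ} (x : Fin n → S) : ℕ → S :=
  fun j => if h : j < n then x ⟨j, h⟩ else x₀ j

lemma extendPath_snoc (x₀ : ℕ → S) {n : ℕ} (x : Fin n → S) (w : S) :
    extendPath x₀ (Fin.snoc x w : Fin (n + 1) → S) = Function.update (extendPath x₀ x) n w := by
  ext j
  rcases lt_trichotomy j n with h | h | h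
  · simp [extendPath, h, h.ne, h.trans (Nat.lt_succ_self n), Fin.snoc]
  · subst h
    simp [extendPath, Fin.snoc]
  · have h1 : ¬ j < n + 1 := by omega
    have h2 : ¬ j < n := by omega
    simp [extendPath, h1, h2, h.ne']

lemma factor_of_dependsOn {β : Type*} {F : (ℕ → S) → β} {n : ℕ} (hF : DependsOn F (Set.Iio n))
    (x₀ : ℕ → S) (z : ℕ → S) :
    F z = F (extendPath x₀ fun j : Fin n => z j) := by
  refine hF fun j hj => ?_
  simp [extendPath, Set.mem_Iio.1 hj]

variable [Fintype S] [MeasurableSpace S] [DiscreteMeasurableSpace S]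
  {P : Matrix S S ℝ} {ν : S → ℝ} {M : Measure (ℕ → S)} {𝕜 : Type*} [RCLike 𝕜]

lemma measurable_of_dependsOn {β : Type*} [MeasurableSpace β] {F : (ℕ → S) → β} {n : ℕ}
    (hF : DependsOn F (Set.Iio n)) : Measurable F := by
  cases isEmpty_or_nonempty (ℕ → S) with
  | inl h => exact measurable_of_empty F
  | inr h =>
    obtain ⟨x₀⟩ := h
    have : F = (fun x : Fin n → S => F (extendPath x₀ x)) ∘ fun z j => z j := by
      ext z
      exact factor_of_dependsOn hF x₀ z
    rw [this]
    exact (Measurable.of_discrete).comp (measurable_pi_iff.2 fun j => measurable_pi_apply _)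

lemma integrable_of_dependsOn {E : Type*} [NormedAddCommGroup E]
    [IsFiniteMeasure M] {F : (ℕ → S) → E} {n : ℕ}
    (hF : DependsOn F (Set.Iio n)) : Integrable F M := by
  cases isEmpty_or_nonempty (ℕ → S) with
  | inl h => exact Integrable.of_isEmpty
  | inr h =>
    obtain ⟨x₀⟩ := h
    have : F = (fun x : Fin n → S => F (extendPath x₀ x)) ∘ fun z j => z j := by
      ext z
      exact factor_of_dependsOn hF x₀ z
    rw [this]
    have hm : Measurable fun (z : ℕ → S) (j : Fin n) => z j :=
      measurable_pi_iff.2 fun j => measurable_pi_apply _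
    exact (Integrable.of_finite (μ := M.map _)).comp_measurable hm

lemma integral_eq_sum_of_dependsOn (hM : IsPathLaw P ν M) {F : (ℕ → S) → 𝕜} {n : ℕ}
    (hF : DependsOn F (Set.Iio n)) (x₀ : ℕ → S) :
    ∫ z, F z ∂M = ∑ x : Fin n → S,
      ((∏ j ∈ range n, stepProb P ν j (extendPath x₀ x) (extendPath x₀ x j) : ℝ) : 𝕜) *
        F (extendPath x₀ x) := by
  have := hM.isProb
  have hm : Measurable fun (z : ℕ → S) (j : Fin n) => z j :=
    measurable_pi_iff.2 fun j => measurable_pi_apply _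
  rw [integral_congr_ae (ae_of_all _ (factor_of_dependsOn hF x₀)),
    ← integral_map (f := fun x : Fin n → S => F (extendPath x₀ x)) hm.aemeasurable
      (Measurable.of_discrete).aestronglyMeasurable,
    integral_fintype Integrable.of_finite]
  refine sum_congr rfl fun x _ => ?_
  rw [← hM.cylinder, RCLike.real_smul_eq_coe_mul, measureReal_def,
    Measure.map_apply hm (measurableSet_singleton x), measureReal_def]
  congr 4
  ext z
  simp only [Set.mem_preimage, Set.mem_singleton_iff, Set.mem_ofPred_eq, funext_iff, Fin.forall_iff]
  refine forall₂_congr fun j hj => ?_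
  simp [extendPath, hj]

/-- The Markov property at time `n`: the state at time `n` may be resampled from its conditional
law given the earlier states. -/
lemma integral_eq_integral_sum_update (hM : IsPathLaw P ν M) {F : (ℕ → S) → 𝕜}
    {n : ℕ} (hF : DependsOn F (Set.Iio (n + 1))) :
    ∫ z, F z ∂M = ∫ z, ∑ w, (stepProb P ν n z w : 𝕜) * F (Function.update z n w) ∂M := by
  have := hM.isProb
  obtain ⟨x₀⟩ : Nonempty (ℕ → S) := nonempty_of_isProbabilityMeasure M
  have hG : DependsOn (fun z => ∑ w, (stepProb P ν n z w : 𝕜) * F (Function.update z n w))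
      (Set.Iio n) := by
    intro x y h
    refine sum_congr rfl fun w _ => ?_
    rw [stepProb_congr P ν h, hF]
    intro j hj
    rcases (Nat.lt_succ_iff_lt_or_eq.1 hj) with hj | rfl
    · simpa [hj.ne] using h j hj
    · simp
  rw [integral_eq_sum_of_dependsOn hM hF x₀, integral_eq_sum_of_dependsOn hM hG x₀,
    ← (Fin.snocEquiv fun _ : Fin (n + 1) => S).sum_comp, Fintype.sum_prod_type_right]
  refine sum_congr rfl fun x _ => ?_
  rw [mul_sum]
  refine sum_congr rfl fun w _ => ?_
  change _ * F (extendPath x₀ (Fin.snoc x w : Fin (n + 1) → S)) = _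
  change ((∏ j ∈ range (n + 1), stepProb P ν j (extendPath x₀ (Fin.snoc x w : Fin (n + 1) → S))
    (extendPath x₀ (Fin.snoc x w : Fin (n + 1) → S) j) : ℝ) : 𝕜) * _ = _
  rw [extendPath_snoc, prod_range_succ, Function.update_self, ← mul_assoc]
  have h : ∀ k ≤ n, ∀ v, stepProb P ν k (Function.update (extendPath x₀ x) n w) v =
      stepProb P ν k (extendPath x₀ x) v := fun k hk v =>
    stepProb_congr P ν (fun j hj => by simp [(hj.trans_le hk).ne]) v
  rw [h n le_rfl]
  push_cast
  congr 2
  refine prod_congr rfl fun j hj => ?_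
  have hj' := mem_range.1 hj
  rw [h j hj'.le, Function.update_of_ne hj'.ne]

/-- The Markov property, several steps at a time. -/
lemma integral_mul_eq_integral_mul_pow [DecidableEq S] (hM : IsPathLaw P ν M) {Φ : (ℕ → S) → ℝ}
    {n : ℕ} (hΦ : DependsOn Φ (Set.Iio (n + 1))) (m : ℕ) (φ : S → ℝ) :
    ∫ z, Φ z * φ (z (n + m)) ∂M = ∫ z, Φ z * ((P ^ m).mulVec φ) (z n) ∂M := by
  induction m generalizing φ with
  | zero => simp
  | succ m ih =>
    have hΦ' : DependsOn (fun z => Φ z * φ (z (n + (m + 1)))) (Set.Iio (n + (m + 1) + 1)) := by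
      intro x y h
      simp only
      rw [hΦ fun j hj => h j (by simp at hj ⊢; omega), h (n + (m + 1)) (by simp)]
    rw [integral_eq_integral_sum_update hM hΦ', pow_succ, ← Matrix.mulVec_mulVec, ← ih]
    refine integral_congr_ae (ae_of_all _ fun z => ?_)
    simp only [Function.update_self, Matrix.mulVec, dotProduct, mul_sum]
    refine sum_congr rfl fun w _ => ?_
    have h1 : Φ (Function.update z (n + (m + 1)) w) = Φ z := by
      refine hΦ fun j hj => ?_
      have : j ≠ n + (m + 1) := by simp at hj; omega
      simp [this]
    rw [h1]
    have h2 : stepProb P ν (n + (m + 1)) z w = P (z (n + m)) w := rfl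
    simp only [h2, RCLike.ofReal_real_eq_id, id]
    ring

/-- Exponential-moment bound along an arithmetic progression of times with gap `L`: if averaging
over `L` steps brings every `φ l` below `q`, each factor but the first costs at most `q`. -/
lemma integral_prod_le [DecidableEq S] (hM : IsPathLaw P ν M) (L r : ℕ)
    {φ : ℕ → S → ℝ}
    {B q : ℝ} (hφ : ∀ l x, 0 ≤ φ l x) (hB : ∀ x, φ 0 x ≤ B) (hq : 0 ≤ q)
    (hstep : ∀ l x, ((P ^ L).mulVec (φ l)) x ≤ q) (K : ℕ) :
    ∫ z, ∏ l ∈ range (K + 1), φ l (z (r + l * L)) ∂M ≤ B * q ^ K := by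
  have := hM.isProb
  have hdep : ∀ K, DependsOn (fun z : ℕ → S => ∏ l ∈ range (K + 1), φ l (z (r + l * L)))
      (Set.Iio (r + K * L + 1)) := by
    intro K x y h
    refine prod_congr rfl fun l hl => ?_
    rw [h (r + l * L)]
    have : l * L ≤ K * L := Nat.mul_le_mul_right L (by simp at hl; omega)
    simp only [Set.mem_Iio]
    omega
  induction K with
  | zero =>
    simp only [zero_add, range_one, prod_singleton, pow_zero, mul_one]
    have := integral_mono (μ := M) (f := fun z => φ 0 (z (r + 0 * L))) (g := fun _ => B)
      (by simpa using integrable_of_dependsOn (M := M) (hdep 0))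
      (integrable_const B) (fun z => hB _)
    simpa using this
  | succ K ih =>
    have h1 : ∀ z : ℕ → S, ∏ l ∈ range (K + 1 + 1), φ l (z (r + l * L)) =
        (∏ l ∈ range (K + 1), φ l (z (r + l * L))) * φ (K + 1) (z (r + K * L + L)) := by
      intro z
      rw [prod_range_succ]
      congr 3
      ring
    simp_rw [h1]
    rw [integral_mul_eq_integral_mul_pow hM (hdep K)]
    have hint := integrable_of_dependsOn (M := M) (hdep K)
    calc _ ≤ ∫ z, (∏ l ∈ range (K + 1), φ l (z (r + l * L))) * q ∂M := by
          refine integral_mono (integrable_of_dependsOn (n := r + K * L + 1) ?_)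
            (hint.mul_const q) fun z => ?_
          · intro x y h
            exact congrArg₂ (· * ·) (hdep K h) (congrArg _ (h (r + K * L) (by simp)))
          · exact mul_le_mul_of_nonneg_left (hstep _ _) (prod_nonneg fun l _ => hφ _ _)
      _ = (∫ z, (∏ l ∈ range (K + 1), φ l (z (r + l * L))) ∂M) * q := integral_mul_const _ _
      _ ≤ B * q ^ K * q := mul_le_mul_of_nonneg_right ih hq
      _ = _ := by ring

end

/-! ### Soft local times and the levels at which they first hit -/

section

variable {S : Type*}

/-- The soft local time `∑_{k < m} ξ_k p(x_{k-1}, z)` at `z` of the first `m` states of the path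
`ω.2 = x`, with waiting times `ω.1 = ξ`; the term `k = 0` is `ξ₀ ν(z)`. -/
def softTime (P : Matrix S S ℝ) (ν : S → ℝ) (m : ℕ) (ω : (ℕ → ℝ) × (ℕ → S)) (z : S) : ℝ :=
  ∑ k ∈ range m, ω.1 k * stepProb P ν k ω.2 z

open Classical in
/-- The soft local time at `z` stopped when the path first visits `z`. -/
noncomputable def stoppedTime (P : Matrix S S ℝ) (ν : S → ℝ) (n : ℕ) (ω : (ℕ → ℝ) × (ℕ → S))
    (z : S) : ℝ :=
  ∑ k ∈ range n, ω.1 k * if ∀ j < k, ω.2 j ≠ z then stepProb P ν k ω.2 z else 0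

/-- The value that the soft local time at `z` has reached when the path first visits `z`. -/
noncomputable def hitLevel (P : Matrix S S ℝ) (ν : S → ℝ) (ω : (ℕ → ℝ) × (ℕ → S)) (z : S) : ℝ :=
  ⨆ n, stoppedTime P ν n ω z

section Deterministic

variable {P : Matrix S S ℝ} {ν : S → ℝ} {ω : (ℕ → ℝ) × (ℕ → S)} {z : S}

lemma stoppedTime_mono (hq : ∀ k, 0 ≤ stepProb P ν k ω.2 z) (hξ : ∀ k, 0 < ω.1 k) :
    Monotone fun n => stoppedTime P ν n ω z := by
  refine monotone_nat_of_le_succ fun n => ?_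
  rw [stoppedTime, stoppedTime, sum_range_succ, le_add_iff_nonneg_right]
  refine mul_nonneg (hξ n).le ?_
  split_ifs
  exacts [hq n, le_rfl]

lemma stoppedTime_eq_of_visit {j n : ℕ} (hj : ω.2 j = z) (hn : j + 1 ≤ n) :
    stoppedTime P ν n ω z = stoppedTime P ν (j + 1) ω z := by
  refine (sum_subset (range_mono hn) fun k _ hk => ?_).symm
  have hk' : j < k := by simpa using hk
  rw [if_neg fun h => h j hk' hj, mul_zero]

lemma stoppedTime_le (hq : ∀ k, 0 ≤ stepProb P ν k ω.2 z) (hξ : ∀ k, 0 < ω.1 k) {j : ℕ}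
    (hj : ω.2 j = z) (n : ℕ) : stoppedTime P ν n ω z ≤ stoppedTime P ν (j + 1) ω z := by
  rcases le_total (j + 1) n with h | h
  · exact (stoppedTime_eq_of_visit hj h).le
  · exact stoppedTime_mono hq hξ h

lemma bddAbove_stoppedTime (hq : ∀ k, 0 ≤ stepProb P ν k ω.2 z) (hξ : ∀ k, 0 < ω.1 k) {j : ℕ}
    (hj : ω.2 j = z) : BddAbove (Set.range fun n => stoppedTime P ν n ω z) := by
  refine ⟨stoppedTime P ν (j + 1) ω z, ?_⟩
  rintro _ ⟨n, rfl⟩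
  exact stoppedTime_le hq hξ hj n

lemma hitLevel_eq (hq : ∀ k, 0 ≤ stepProb P ν k ω.2 z) (hξ : ∀ k, 0 < ω.1 k) {j n : ℕ}
    (hj : ω.2 j = z) (hn : j + 1 ≤ n) : hitLevel P ν ω z = stoppedTime P ν n ω z := by
  rw [stoppedTime_eq_of_visit hj hn]
  exact le_antisymm (ciSup_le fun n => stoppedTime_le hq hξ hj n)
    (le_ciSup (bddAbove_stoppedTime hq hξ hj) (j + 1))

lemma hitLevel_le_softTime (hq : ∀ k, 0 ≤ stepProb P ν k ω.2 z) (hξ : ∀ k, 0 < ω.1 k) {j m : ℕ}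
    (hj : ω.2 j = z) (hm : j < m) : hitLevel P ν ω z ≤ softTime P ν m ω z := by
  rw [hitLevel_eq hq hξ hj hm]
  refine sum_le_sum fun k _ => mul_le_mul_of_nonneg_left ?_ (hξ k).le
  split_ifs
  exacts [le_rfl, hq k]

lemma softTime_le_hitLevel (hq : ∀ k, 0 ≤ stepProb P ν k ω.2 z) (hξ : ∀ k, 0 < ω.1 k) {m : ℕ}
    (hvis : ∃ j, ω.2 j = z) (hm : ∀ j < m, ω.2 j ≠ z) :
    softTime P ν m ω z ≤ hitLevel P ν ω z := by
  obtain ⟨j, hj⟩ := hvis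
  have h : softTime P ν m ω z = stoppedTime P ν m ω z := by
    refine sum_congr rfl fun k hk => ?_
    rw [if_pos fun i hi => hm i (hi.trans (mem_range.1 hk))]
  rw [h]
  exact le_ciSup (bddAbove_stoppedTime hq hξ hj) m

end Deterministic

lemma dependsOn_stepProb (P : Matrix S S ℝ) (ν : S → ℝ) (k : ℕ) (z : S) :
    DependsOn (fun x => stepProb P ν k x z) (Set.Iio k) :=
  fun _ _ h => stepProb_congr P ν h z

open Classical in
lemma dependsOn_fresh (P : Matrix S S ℝ) (ν : S → ℝ) (k : ℕ) (z : S) :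
    DependsOn (fun x : ℕ → S => if ∀ j < k, x j ≠ z then stepProb P ν k x z else 0)
      (Set.Iio k) := by
  intro x y h
  have : (∀ j < k, x j ≠ z) ↔ ∀ j < k, y j ≠ z := forall₂_congr fun j hj => by rw [h j hj]
  simp only [this, stepProb_congr P ν h z]

section CondCharFun
open Classical Complex

variable [Fintype S] {P : Matrix S S ℝ} {ν : S → ℝ}

/-- The coefficient of `ξ_k` in `∑_z t_z U_z`, where `U` is the vector of stopped soft local times.
-/
noncomputable def freshSum (P : Matrix S S ℝ) (ν : S → ℝ) (t : S → ℝ) (k : ℕ) (x : ℕ → S) : ℝ :=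
  ∑ z, t z * if ∀ j < k, x j ≠ z then stepProb P ν k x z else 0

/-- Conditional characteristic function, given the first `n` states, of the levels at which the
soft local times first hit their states. Its mean does not depend on `n`. -/
noncomputable def condCharFun (P : Matrix S S ℝ) (ν : S → ℝ) (t : S → ℝ) (n : ℕ) (x : ℕ → S) : ℂ :=
  (∏ k ∈ range n, (1 - I * freshSum P ν t k x)⁻¹) *
    ∏ z, if ∀ j < n, x j ≠ z then (1 - I * (t z : ℂ))⁻¹ else 1

lemma dependsOn_freshSum (P : Matrix S S ℝ) (ν : S → ℝ) (t : S → ℝ) (k : ℕ) :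
    DependsOn (freshSum P ν t k) (Set.Iio k) := fun _ _ h =>
  sum_congr rfl fun z _ => congrArg (t z * ·) (dependsOn_fresh P ν k z h)

lemma dependsOn_prod_freshSum (P : Matrix S S ℝ) (ν : S → ℝ) (t : S → ℝ) (n : ℕ) :
    DependsOn (fun x => ∏ k ∈ range n, (1 - I * freshSum P ν t k x : ℂ)⁻¹) (Set.Iio n) := by
  intro x y h
  refine prod_congr rfl fun k hk => ?_
  rw [dependsOn_freshSum P ν t k fun j hj => h j (lt_trans hj (mem_range.1 hk))]

lemma dependsOn_condCharFun (P : Matrix S S ℝ) (ν : S → ℝ) (t : S → ℝ) (n : ℕ) :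
    DependsOn (condCharFun P ν t n) (Set.Iio n) := by
  intro x y h
  refine congrArg₂ (· * ·) (dependsOn_prod_freshSum P ν t n h) (prod_congr rfl fun z _ => ?_)
  have : (∀ j < n, x j ≠ z) ↔ ∀ j < n, y j ≠ z := forall₂_congr fun j hj => by rw [h j hj]
  simp only [this]

lemma one_sub_I_mul_ne_zero (s : ℝ) : (1 - I * (s : ℂ)) ≠ 0 := by
  intro h
  simpa using congrArg Complex.re h

lemma norm_inv_one_sub_I_mul_le (s : ℝ) : ‖(1 - I * (s : ℂ))⁻¹‖ ≤ 1 := by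
  rw [norm_inv]
  refine inv_le_one_of_one_le₀ ?_
  have := Complex.abs_re_le_norm (1 - I * (s : ℂ))
  simpa using this

lemma norm_prod_freshSum_le (t : S → ℝ) (n : ℕ) (x : ℕ → S) :
    ‖∏ k ∈ range n, (1 - I * freshSum P ν t k x : ℂ)⁻¹‖ ≤ 1 := by
  rw [norm_prod]
  exact prod_le_one (fun _ _ => norm_nonneg _) fun _ _ => norm_inv_one_sub_I_mul_le _

lemma norm_condCharFun_le (t : S → ℝ) (n : ℕ) (x : ℕ → S) : ‖condCharFun P ν t n x‖ ≤ 1 := by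
  rw [condCharFun, norm_mul]
  refine mul_le_one₀ (norm_prod_freshSum_le t n x) (norm_nonneg _) ?_
  rw [norm_prod]
  refine prod_le_one (fun _ _ => norm_nonneg _) fun z _ => ?_
  split_ifs
  exacts [norm_inv_one_sub_I_mul_le _, by simp]

end CondCharFun

variable [Fintype S] [MeasurableSpace S] [DiscreteMeasurableSpace S]
  {P : Matrix S S ℝ} {ν : S → ℝ} {M : Measure (ℕ → S)}

lemma measurable_softTime (P : Matrix S S ℝ) (ν : S → ℝ) (m : ℕ) (z : S) :
    Measurable fun ω => softTime P ν m ω z := by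
  refine Finset.measurable_fun_sum _ fun k _ => Measurable.mul (by fun_prop) ?_
  exact (measurable_of_dependsOn (dependsOn_stepProb P ν k z)).comp measurable_snd

lemma measurable_stoppedTime (P : Matrix S S ℝ) (ν : S → ℝ) (n : ℕ) :
    Measurable (stoppedTime P ν n) := by
  refine measurable_pi_iff.2 fun z => ?_
  refine Finset.measurable_fun_sum _ fun k _ => Measurable.mul (by fun_prop) ?_
  exact (measurable_of_dependsOn (dependsOn_fresh P ν k z)).comp measurable_snd

lemma measurable_hitLevel (P : Matrix S S ℝ) (ν : S → ℝ) : Measurable (hitLevel P ν) :=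
  measurable_pi_iff.2 fun z =>
    Measurable.iSup fun n => (measurable_pi_apply z).comp (measurable_stoppedTime P ν n)

section Law
open Classical Complex

/-- One step of the chain: averaging over the next state `w` of probability `q w` multiplies the
product over the unvisited states by `∑_w q w (1 - i t_w 1_{w unvisited})`, which the waiting time
of the step cancels. -/
lemma integral_condCharFun_succ (hM : IsPathLaw P ν M)
    (hq : ∀ k x, stepProb P ν k x ∈ stdSimplex ℝ S) (t : S → ℝ) (n : ℕ) :
    ∫ x, condCharFun P ν t (n + 1) x ∂M = ∫ x, condCharFun P ν t n x ∂M := by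
  rw [integral_eq_integral_sum_update hM (dependsOn_condCharFun P ν t (n + 1))]
  refine integral_congr_ae (ae_of_all _ fun x => ?_)
  have hfresh : ∀ z w, (∀ j < n + 1, Function.update x n w j ≠ z) ↔
      (∀ j < n, x j ≠ z) ∧ w ≠ z := by
    intro z w
    rw [Nat.forall_lt_succ_right, Function.update_self]
    refine and_congr_left fun _ => forall₂_congr fun j hj => ?_
    rw [Function.update_of_ne hj.ne]
  have hprod : ∀ w, (∏ k ∈ range (n + 1), (1 - I * freshSum P ν t k (Function.update x n w))⁻¹) =
      (∏ k ∈ range n, (1 - I * freshSum P ν t k x)⁻¹) * (1 - I * freshSum P ν t n x)⁻¹ := by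
    intro w
    rw [← prod_range_succ]
    refine prod_congr rfl fun k hk => ?_
    rw [dependsOn_freshSum P ν t k (x := Function.update x n w) (y := x)]
    intro j hj
    have : j < n := lt_of_lt_of_le hj (Nat.lt_succ_iff.1 (mem_range.1 hk))
    simp [this.ne]
  have hR : ∀ w, (∏ z, if ∀ j < n + 1, Function.update x n w j ≠ z
        then (1 - I * (t z : ℂ))⁻¹ else 1) =
      (if ∀ j < n, x j ≠ w then (1 - I * (t w : ℂ)) else 1) *
        ∏ z, if ∀ j < n, x j ≠ z then (1 - I * (t z : ℂ))⁻¹ else 1 := by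
    intro w
    rw [← mul_prod_erase univ _ (mem_univ w),
      ← mul_prod_erase univ (fun z => if ∀ j < n, x j ≠ z then (1 - I * (t z : ℂ))⁻¹ else 1)
        (mem_univ w), ← mul_assoc]
    congr 1
    · simp only [hfresh, ne_eq, not_true_eq_false, and_false, if_false]
      split_ifs
      · rw [mul_inv_cancel₀ (one_sub_I_mul_ne_zero _)]
      · rw [one_mul]
    · refine prod_congr rfl fun z hz => ?_
      have : w ≠ z := (ne_of_mem_erase hz).symm
      simp only [hfresh, this, ne_eq, not_false_eq_true, and_true]
  have hsum : ∑ w, (stepProb P ν n x w : ℂ) *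
      (if ∀ j < n, x j ≠ w then (1 - I * (t w : ℂ)) else 1) = 1 - I * freshSum P ν t n x := by
    have h1 : (∑ w, (stepProb P ν n x w : ℂ)) = 1 := by
      exact_mod_cast (hq n x).2
    rw [freshSum]
    push_cast
    rw [mul_sum]
    conv_rhs => rw [← h1]
    rw [← sum_sub_distrib]
    refine sum_congr rfl fun w _ => ?_
    split_ifs
    · ring
    · simp
  simp only [condCharFun, hprod, hR]
  have hne := one_sub_I_mul_ne_zero (freshSum P ν t n x)
  calc _ = (∑ w, (stepProb P ν n x w : ℂ) *
        (if ∀ j < n, x j ≠ w then (1 - I * (t w : ℂ)) else 1)) *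
        (1 - I * freshSum P ν t n x)⁻¹ * ((∏ k ∈ range n, (1 - I * freshSum P ν t k x)⁻¹) *
        ∏ z, if ∀ j < n, x j ≠ z then (1 - I * (t z : ℂ))⁻¹ else 1) := by
        rw [sum_mul, sum_mul]
        refine sum_congr rfl fun w _ => ?_
        change (stepProb P ν n x w : ℂ) * _ = _
        ring
    _ = _ := by rw [hsum, mul_inv_cancel₀ hne, one_mul]

lemma integral_condCharFun (hM : IsPathLaw P ν M)
    (hq : ∀ k x, stepProb P ν k x ∈ stdSimplex ℝ S) (t : S → ℝ) (n : ℕ) :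
    ∫ x, condCharFun P ν t n x ∂M = ∏ z, (1 - I * (t z : ℂ))⁻¹ := by
  have := hM.isProb
  induction n with
  | zero => simp [condCharFun]
  | succ n ih => rw [integral_condCharFun_succ hM hq, ih]

lemma integral_cexp_stoppedTime (hM : IsPathLaw P ν M) (t : S → ℝ) (n : ℕ) :
    ∫ ω, cexp (I * ∑ z, t z * stoppedTime P ν n ω z) ∂(waitingLaw.prod M) =
      ∫ x, ∏ k ∈ range n, (1 - I * freshSum P ν t k x : ℂ)⁻¹ ∂M := by
  have := hM.isProb
  have hmeas : Measurable fun ω : (ℕ → ℝ) × (ℕ → S) =>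
      cexp (I * ∑ z, t z * stoppedTime P ν n ω z) := by
    have h : ∀ z, Measurable fun ω => stoppedTime P ν n ω z := fun z =>
      (measurable_pi_apply z).comp (measurable_stoppedTime P ν n)
    fun_prop
  rw [integral_prod_symm]
  · refine integral_congr_ae (ae_of_all _ fun x => ?_)
    have hc := integral_cexp_waitingLaw n (fun k => I * freshSum P ν t k x) (by simp)
    simp only at hc ⊢
    rw [← hc]
    refine integral_congr_ae (ae_of_all _ fun ξ => ?_)
    simp only [stoppedTime, freshSum]
    congr 1
    push_cast
    simp_rw [mul_sum, sum_mul]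
    rw [sum_comm]
    refine sum_congr rfl fun k _ => sum_congr rfl fun z _ => ?_
    ring
  · refine Integrable.of_bound hmeas.aestronglyMeasurable 1 (ae_of_all _ fun ω => ?_)
    rw [mul_comm]
    have := Complex.norm_exp_ofReal_mul_I (∑ z, t z * stoppedTime P ν n ω z)
    exact this.le

/-- The levels at which the soft local times first hit their states are independent standard
exponential variables; in particular their law does not depend on the chain. -/
theorem integral_cexp_hitLevel (hM : IsPathLaw P ν M)
    (hq : ∀ k x, stepProb P ν k x ∈ stdSimplex ℝ S) (hvis : ∀ᵐ x ∂M, ∀ z, ∃ j, x j = z)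
    (t : S → ℝ) :
    ∫ ω, cexp (I * ∑ z, t z * hitLevel P ν ω z) ∂(waitingLaw.prod M) =
      ∏ z, (1 - I * (t z : ℂ))⁻¹ := by
  have := hM.isProb
  have hmeas : ∀ n, Measurable fun ω : (ℕ → ℝ) × (ℕ → S) =>
      cexp (I * ∑ z, t z * stoppedTime P ν n ω z) := by
    intro n
    have h : ∀ z, Measurable fun ω => stoppedTime P ν n ω z := fun z =>
      (measurable_pi_apply z).comp (measurable_stoppedTime P ν n)
    fun_prop
  have hξ : ∀ᵐ ω ∂(waitingLaw.prod M), ∀ k, 0 < ω.1 k :=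
    Measure.quasiMeasurePreserving_fst.ae ae_pos_waitingLaw
  have hv : ∀ᵐ ω ∂(waitingLaw.prod M), ∀ z, ∃ j, ω.2 j = z :=
    Measure.quasiMeasurePreserving_snd.ae hvis
  have lim1 : Filter.Tendsto
      (fun n => ∫ ω, cexp (I * ∑ z, t z * stoppedTime P ν n ω z) ∂(waitingLaw.prod M))
      Filter.atTop (nhds (∫ ω, cexp (I * ∑ z, t z * hitLevel P ν ω z) ∂(waitingLaw.prod M))) := by
    refine tendsto_integral_of_dominated_convergence (fun _ => 1)
      (fun n => (hmeas n).aestronglyMeasurable) (integrable_const _)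
      (fun n => ae_of_all _ fun ω => ?_) ?_
    · rw [mul_comm]
      have := Complex.norm_exp_ofReal_mul_I (∑ z, t z * stoppedTime P ν n ω z)
      exact this.le
    · filter_upwards [hξ, hv] with ω h1 h2
      choose j hj using h2
      refine tendsto_const_nhds.congr' ?_
      filter_upwards [Filter.eventually_ge_atTop (univ.sup fun z => j z + 1)] with n hn
      congr 3
      refine sum_congr rfl fun z _ => ?_
      rw [hitLevel_eq (fun k => (hq k ω.2).1 z) h1 (hj z)
        ((le_sup (f := fun z => j z + 1) (mem_univ z)).trans hn)]
  have lim2 : Filter.Tendsto (fun n => ∫ x, ((∏ k ∈ range n, (1 - I * freshSum P ν t k x : ℂ)⁻¹) -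
      condCharFun P ν t n x) ∂M) Filter.atTop (nhds (∫ _, (0 : ℂ) ∂M)) := by
    refine tendsto_integral_of_dominated_convergence (fun _ => 2)
      (fun n => ?_) (integrable_const _) (fun n => ae_of_all _ fun x => ?_) ?_
    · exact ((measurable_of_dependsOn (dependsOn_prod_freshSum P ν t n)).sub
        (measurable_of_dependsOn (dependsOn_condCharFun P ν t n))).aestronglyMeasurable
    · calc _ ≤ 1 + 1 := norm_sub_le_of_le (norm_prod_freshSum_le t n x) (norm_condCharFun_le t n x)
        _ = 2 := by norm_num
    · filter_upwards [hvis] with x h2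
      choose j hj using h2
      refine tendsto_const_nhds.congr' ?_
      filter_upwards [Filter.eventually_ge_atTop (univ.sup fun z => j z + 1)] with n hn
      have : ∀ z, ¬ ∀ i < n, x i ≠ z := fun z h =>
        h (j z) ((le_sup (f := fun z => j z + 1) (mem_univ z)).trans hn) (hj z)
      simp [condCharFun, this]
  have heq : ∀ n, ∫ ω, cexp (I * ∑ z, t z * stoppedTime P ν n ω z) ∂(waitingLaw.prod M) =
      (∫ x, ((∏ k ∈ range n, (1 - I * freshSum P ν t k x : ℂ)⁻¹) -
        condCharFun P ν t n x) ∂M) + ∏ z, (1 - I * (t z : ℂ))⁻¹ := by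
    intro n
    rw [integral_sub (integrable_of_dependsOn (dependsOn_prod_freshSum P ν t n))
      (integrable_of_dependsOn (dependsOn_condCharFun P ν t n)), integral_condCharFun hM hq,
      integral_cexp_stoppedTime hM, sub_add_cancel]
  refine tendsto_nhds_unique lim1 ?_
  simp_rw [heq]
  simpa using lim2.add_const (∏ z, (1 - I * (t z : ℂ))⁻¹)

/-- The law of the hitting levels is the same for any two chains. -/
theorem map_hitLevel_eq {P' : Matrix S S ℝ} {ν' : S → ℝ} {M' : Measure (ℕ → S)}
    (hM : IsPathLaw P ν M) (hq : ∀ k x, stepProb P ν k x ∈ stdSimplex ℝ S)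
    (hvis : ∀ᵐ x ∂M, ∀ z, ∃ j, x j = z)
    (hM' : IsPathLaw P' ν' M') (hq' : ∀ k x, stepProb P' ν' k x ∈ stdSimplex ℝ S)
    (hvis' : ∀ᵐ x ∂M', ∀ z, ∃ j, x j = z) :
    (waitingLaw.prod M).map (hitLevel P ν) = (waitingLaw.prod M').map (hitLevel P' ν') := by
  have := hM.isProb
  have := hM'.isProb
  have key : ∀ {P : Matrix S S ℝ} {ν : S → ℝ} {M : Measure (ℕ → S)} (_ : IsPathLaw P ν M)
      (_ : ∀ k x, stepProb P ν k x ∈ stdSimplex ℝ S) (_ : ∀ᵐ x ∂M, ∀ z, ∃ j, x j = z)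
      (ℓ : StrongDual ℝ (S → ℝ)), charFunDual ((waitingLaw.prod M).map (hitLevel P ν)) ℓ =
        ∏ z, (1 - I * (ℓ (Pi.single z 1) : ℂ))⁻¹ := by
    intro P ν M hM hq hvis ℓ
    rw [charFunDual_apply, integral_map (measurable_hitLevel P ν).aemeasurable (by fun_prop),
      ← integral_cexp_hitLevel hM hq hvis]
    refine integral_congr_ae (ae_of_all _ fun ω => ?_)
    have : ℓ (hitLevel P ν ω) = ∑ z, ℓ (Pi.single z 1) * hitLevel P ν ω z := by
      conv_lhs => rw [pi_eq_sum_univ' (hitLevel P ν ω)]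
      rw [map_sum]
      refine sum_congr rfl fun z _ => ?_
      rw [map_smul, smul_eq_mul, mul_comm]
    simp only [this]
    push_cast
    rw [mul_comm]
  refine Measure.ext_of_charFunDual (funext fun ℓ => ?_)
  rw [key hM hq hvis, key hM' hq' hvis']

end Law

end

/-! ### Mixing and recurrence -/

section

variable {S : Type*} [Fintype S] {P : Matrix S S ℝ} {ν π : S → ℝ}

lemma piMin_pos [Nonempty S] (hπ : ∀ z, 0 < π z) : 0 < piMin π := by
  obtain ⟨z, hz⟩ := exists_eq_ciInf_of_finite (f := π)
  rw [piMin, ← hz]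
  exact hπ z

lemma piMin_le (π : S → ℝ) (z : S) : piMin π ≤ π z :=
  ciInf_le (Set.finite_range π).bddBelow z

variable [DecidableEq S]

lemma vecMul_pow_eq (hπP : Matrix.vecMul π P = π) (n : ℕ) : Matrix.vecMul π (P ^ n) = π := by
  induction n with
  | zero => simp
  | succ n ih => rw [pow_succ, ← Matrix.vecMul_vecMul, ih, hπP]

lemma invariant_pos (hP : P.IsIrreducible) (hπ : π ∈ stdSimplex ℝ S)
    (hπP : Matrix.vecMul π P = π) (z : S) : 0 < π z := by
  obtain ⟨x, -, hx⟩ : ∃ x ∈ univ, 0 < π x := by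
    refine exists_lt_of_sum_lt (f := fun _ => (0 : ℝ)) ?_
    rw [hπ.2, sum_const_zero]
    exact one_pos
  obtain ⟨k, -, hk⟩ := (Matrix.isIrreducible_iff_exists_pow_pos hP.nonneg).1 hP x z
  have h := congrFun (vecMul_pow_eq hπP k) z
  rw [← h]
  simp only [Matrix.vecMul, dotProduct]
  refine sum_pos' (fun y _ => mul_nonneg (hπ.1 y) (Matrix.pow_apply_nonneg hP.nonneg k y z))
    ⟨x, mem_univ x, mul_pos hx hk⟩

/-- The distance to the invariant law halves over each mixing time: `P ^ T` contracts the
`ℓ¹` norm of a vector of total mass zero by the factor `1/2`. -/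
lemma sum_abs_pow_sub_le (hP : P ∈ Matrix.rowStochastic ℝ S) (hπ : π ∈ stdSimplex ℝ S)
    (hπP : Matrix.vecMul π P = π) {T : ℕ} (hT : ∀ x, tvDist ((P ^ T) x) π ≤ 1 / 4) (j : ℕ) (x : S) :
    ∑ y, |(P ^ (T * j)) x y - π y| ≤ 2 * (1 / 2) ^ j := by
  have hrow : ∀ n x, ∑ y, (P ^ n) x y = 1 := fun n x =>
    Matrix.sum_row_of_mem_rowStochastic (pow_mem hP n) x
  induction j with
  | zero =>
    calc _ ≤ ∑ y, (|(P ^ (T * 0)) x y| + |π y|) := sum_le_sum fun y _ => abs_sub _ _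
      _ = ∑ y, ((P ^ (T * 0)) x y + π y) := sum_congr rfl fun y _ => by
        rw [abs_of_nonneg ((pow_mem hP (T * 0)).1 x y), abs_of_nonneg (hπ.1 y)]
      _ = _ := by rw [sum_add_distrib, hrow, hπ.2]; norm_num
  | succ j ih =>
    set v : S → ℝ := fun w => (P ^ (T * j)) x w - π w with hv
    have hv0 : ∑ w, v w = 0 := by rw [hv, sum_sub_distrib, hrow, hπ.2, sub_self]
    have h1 : ∀ y, (P ^ (T * (j + 1))) x y - π y = ∑ w, v w * ((P ^ T) w y - π y) := by
      intro y
      have h2 := congrFun (vecMul_pow_eq hπP T) y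
      simp only [Matrix.vecMul, dotProduct] at h2
      simp_rw [mul_sub]
      rw [sum_sub_distrib, ← sum_mul, hv0, zero_mul, sub_zero, Nat.mul_succ, pow_add,
        Matrix.mul_apply]
      simp_rw [hv, sub_mul]
      rw [sum_sub_distrib, h2]
    calc _ = ∑ y, |∑ w, v w * ((P ^ T) w y - π y)| := by simp_rw [h1]
      _ ≤ ∑ y, ∑ w, |v w| * |(P ^ T) w y - π y| := sum_le_sum fun y _ =>
          (abs_sum_le_sum_abs _ _).trans_eq (sum_congr rfl fun w _ => abs_mul _ _)
      _ = ∑ w, |v w| * ∑ y, |(P ^ T) w y - π y| := by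
          rw [sum_comm]
          simp_rw [mul_sum]
      _ ≤ ∑ w, |v w| * (1 / 2) := by
          refine sum_le_sum fun w _ => mul_le_mul_of_nonneg_left ?_ (abs_nonneg _)
          have := hT w
          rw [tvDist] at this
          linarith
      _ = (∑ w, |v w|) * (1 / 2) := (sum_mul _ _ _).symm
      _ ≤ 2 * (1 / 2) ^ j * (1 / 2) := mul_le_mul_of_nonneg_right ih (by norm_num)
      _ = _ := by ring

lemma abs_pow_sub_le (hP : P ∈ Matrix.rowStochastic ℝ S) (hπ : π ∈ stdSimplex ℝ S)
    (hπP : Matrix.vecMul π P = π) {T : ℕ} (hT : ∀ x, tvDist ((P ^ T) x) π ≤ 1 / 4) (j : ℕ)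
    (x y : S) : |(P ^ (T * j)) x y - π y| ≤ 2 * (1 / 2) ^ j :=
  (single_le_sum (f := fun y => |(P ^ (T * j)) x y - π y|) (fun _ _ => abs_nonneg _)
    (mem_univ y)).trans (sum_abs_pow_sub_le hP hπ hπP hT j x)

lemma mulVec_pow_le [Nonempty S] (hP : P ∈ Matrix.rowStochastic ℝ S) (hπ : π ∈ stdSimplex ℝ S)
    (hpos : ∀ z, 0 < π z) (hπP : Matrix.vecMul π P = π) {T : ℕ}
    (hT : ∀ x, tvDist ((P ^ T) x) π ≤ 1 / 4) (j : ℕ) {φ : S → ℝ} (hφ : ∀ y, 0 ≤ φ y) (x : S) :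
    ((P ^ (T * j)).mulVec φ) x ≤ (1 + 2 * (1 / 2) ^ j / piMin π) * mean π φ := by
  simp only [Matrix.mulVec, dotProduct, mean, mul_sum]
  refine sum_le_sum fun y _ => ?_
  rw [← mul_assoc]
  refine mul_le_mul_of_nonneg_right ?_ (hφ y)
  have h1 := (abs_le.1 (abs_pow_sub_le hP hπ hπP hT j x y)).2
  have h2 : 2 * (1 / 2 : ℝ) ^ j ≤ 2 * (1 / 2) ^ j / piMin π * π y := by
    rw [div_mul_eq_mul_div, le_div_iff₀ (piMin_pos hpos)]
    exact mul_le_mul_of_nonneg_left (piMin_le π y) (by positivity)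
  linarith

variable [MeasurableSpace S] [DiscreteMeasurableSpace S] {M : Measure (ℕ → S)}

lemma ae_forall_visited (hM : IsPathLaw P ν M) (hP : P ∈ Matrix.rowStochastic ℝ S)
    (hπ : π ∈ stdSimplex ℝ S) (hpos : ∀ z, 0 < π z) (hπP : Matrix.vecMul π P = π) {T : ℕ}
    (hT : ∀ x, tvDist ((P ^ T) x) π ≤ 1 / 4) : ∀ᵐ x ∂M, ∀ z, ∃ j, x j = z := by
  have := hM.isProb
  rw [ae_all_iff]
  intro z
  obtain ⟨j, hj⟩ := exists_pow_lt_of_lt_one (show (0 : ℝ) < π z / 4 by linarith [hpos z])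
    (show (1 / 2 : ℝ) < 1 by norm_num)
  set q : ℝ := 1 - π z / 2 with hq
  have hπ1 : π z ≤ 1 := hπ.2 ▸ single_le_sum (fun y _ => hπ.1 y) (mem_univ z)
  have hstep : ∀ x, ((P ^ (T * j)).mulVec fun y => if y = z then 0 else 1) x ≤ q := by
    intro x
    have h1 := (abs_le.1 (abs_pow_sub_le hP hπ hπP hT j x z)).1
    have h2 : ((P ^ (T * j)).mulVec fun y => if y = z then 0 else 1) x =
        1 - (P ^ (T * j)) x z := by
      have h3 := Matrix.sum_row_of_mem_rowStochastic (pow_mem hP (T * j)) x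
      rw [← add_sum_erase univ _ (mem_univ z)] at h3
      rw [← eq_sub_of_add_eq' h3, Matrix.mulVec, dotProduct,
        ← add_sum_erase univ _ (mem_univ z)]
      simp only [if_true, mul_zero, zero_add]
      refine sum_congr rfl fun y hy => ?_
      have hyz : y ≠ z := ne_of_mem_erase hy
      simp [hyz]
    rw [h2]
    linarith
  have hbound : ∀ K : ℕ, M.real {x | ∀ j, x j ≠ z} ≤ q ^ K := by
    intro K
    have h1 := integral_prod_le hM (T * j) 0 (φ := fun _ y => if y = z then 0 else 1) (B := 1)
      (fun _ y => by split_ifs <;> norm_num) (fun y => by split_ifs <;> norm_num)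
      (by linarith) (fun _ x => hstep x) K
    rw [one_mul] at h1
    refine le_trans ?_ h1
    have hms : MeasurableSet {x : ℕ → S | ∀ j, x j ≠ z} := by
      have : {x : ℕ → S | ∀ j, x j ≠ z} = ⋂ j, (fun x : ℕ → S => x j) ⁻¹' {z}ᶜ := by
        ext; simp
      rw [this]
      exact MeasurableSet.iInter fun j => measurable_pi_apply j (measurableSet_singleton z).compl
    rw [← integral_indicator_one hms]
    refine integral_mono ((integrable_const 1).indicator hms)
      (integrable_of_dependsOn (n := K * (T * j) + 1) ?_) fun x => ?_
    · intro x y h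
      refine prod_congr rfl fun l hl => ?_
      rw [h (0 + l * (T * j))]
      have : l * (T * j) ≤ K * (T * j) := Nat.mul_le_mul_right _ (by simp at hl; omega)
      simp only [Set.mem_Iio]
      omega
    · by_cases hx : x ∈ {x : ℕ → S | ∀ j, x j ≠ z}
      · rw [Set.indicator_of_mem hx]
        simp only [Pi.one_apply]
        rw [prod_eq_one fun l _ => if_neg (hx _)]
      · rw [Set.indicator_of_notMem hx]
        exact prod_nonneg fun l _ => by split_ifs <;> norm_num
  have h0 : M.real {x | ∀ j, x j ≠ z} ≤ 0 :=
    ge_of_tendsto' (tendsto_pow_atTop_nhds_zero_of_lt_one (by linarith) (by linarith [hpos z]))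
      hbound
  have h0' : M {x | ∀ j, x j ≠ z} = 0 :=
    (measureReal_eq_zero_iff).1 (le_antisymm h0 measureReal_nonneg)
  rw [ae_iff]
  simpa using h0'

end

/-! ### Exponential moments and tail bounds -/

section

lemma sum_range_mul_eq (f : ℕ → ℝ) (L K : ℕ) :
    ∑ k ∈ range (L * K), f k = ∑ r ∈ range L, ∑ l ∈ range K, f (r + l * L) := by
  induction K with
  | zero => simp
  | succ K ih =>
    rw [Nat.mul_succ, sum_range_add, ih, ← sum_add_distrib]
    refine sum_congr rfl fun r _ => ?_
    rw [sum_range_succ, mul_comm L K, add_comm (K * L) r]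

lemma sum_range_eq_sum_residues (f : ℕ → ℝ) {L : ℕ} (hL : 0 < L) (N : ℕ) :
    ∑ k ∈ range N, f k =
      ∑ r ∈ range L, ∑ l ∈ range (N / L + 1), if r + l * L < N then f (r + l * L) else 0 := by
  rw [← sum_range_mul_eq (fun k => if k < N then f k else 0), ← sum_filter]
  congr 1
  ext k
  have := Nat.lt_mul_div_succ N hL
  simp only [mem_filter, mem_range]
  omega

lemma inv_one_sub_le {y : ℝ} (hy : |y| ≤ 1 / 2) : (1 - y)⁻¹ ≤ 1 + y + 2 * y ^ 2 := by
  have h := abs_le.1 hy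
  rw [inv_le_iff_one_le_mul₀ (by linarith)]
  nlinarith [mul_nonneg (sq_nonneg y) (show 0 ≤ 1 - 2 * y by linarith)]

/-- Convexity of the exponential: the sum over `k < N` is split into residue classes mod `L`. -/
lemma exp_sum_le_residues (f : ℕ → ℝ) {L : ℕ} (hL : 0 < L) (N : ℕ) (θ : ℝ) :
    Real.exp (θ / L * ∑ k ∈ range N, f k) ≤ ∑ r ∈ range L, (L : ℝ)⁻¹ *
      Real.exp (∑ l ∈ range (N / L + 1), if r + l * L < N then θ * f (r + l * L) else 0) := by
  have hL' : (L : ℝ) ≠ 0 := by positivity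
  have h := convexOn_exp.map_sum_le (t := range L) (w := fun _ => (L : ℝ)⁻¹)
    (p := fun r => ∑ l ∈ range (N / L + 1), if r + l * L < N then θ * f (r + l * L) else 0)
    (fun _ _ => by positivity) (by simp [hL']) (fun _ _ => Set.mem_univ _)
  simp only [smul_eq_mul] at h
  refine le_trans (le_of_eq ?_) h
  rw [sum_range_eq_sum_residues f hL, ← mul_sum, div_mul_eq_mul_div, div_eq_inv_mul, mul_sum]
  congr 2
  refine sum_congr rfl fun r _ => ?_
  rw [mul_sum]
  exact sum_congr rfl fun l _ => by split_ifs <;> simp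

/-- Markov's inequality for the exponential of `t X`. -/
lemma measure_le_of_lintegral_exp_le {Ω : Type*} [MeasurableSpace Ω] {Q : Measure Ω} {X : Ω → ℝ}
    (hX : Measurable X) {t B : ℝ} (ht : 0 ≤ t) (hB : 0 ≤ B)
    (h : ∫⁻ ω, ENNReal.ofReal (Real.exp (t * X ω)) ∂Q ≤ ENNReal.ofReal B) (a : ℝ) :
    Q.real {ω | a ≤ X ω} ≤ B * Real.exp (-(t * a)) := by
  have hmarkov := mul_meas_ge_le_lintegral₀ (μ := Q)
    (f := fun ω => ENNReal.ofReal (Real.exp (t * X ω))) (by fun_prop)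
    (ENNReal.ofReal (Real.exp (t * a)))
  have hsub : {ω | a ≤ X ω} ⊆ {ω | ENNReal.ofReal (Real.exp (t * a)) ≤
      ENNReal.ofReal (Real.exp (t * X ω))} := fun ω hω =>
    ENNReal.ofReal_le_ofReal (Real.exp_le_exp.2 (mul_le_mul_of_nonneg_left hω ht))
  have h2 := ENNReal.toReal_mono ENNReal.ofReal_ne_top
    ((mul_le_mul_right (measure_mono hsub) (ENNReal.ofReal (Real.exp (t * a)))).trans
      (hmarkov.trans h))
  rw [ENNReal.toReal_mul, ENNReal.toReal_ofReal (Real.exp_pos _).le,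
    ENNReal.toReal_ofReal hB] at h2
  rw [Real.exp_neg, ← div_eq_mul_inv, le_div_iff₀ (Real.exp_pos _), mul_comm]
  exact h2

lemma lintegral_fst_exp_le {S : Type*} [MeasurableSpace S] {M : Measure (ℕ → S)}
    [IsProbabilityMeasure M] (n : ℕ) {c : ℝ} (hc : c < 1) {e : ℕ → ℕ} (he : e.Injective) :
    ∫⁻ ω, ENNReal.ofReal (Real.exp (∑ k ∈ range n, c * ω.1 (e k))) ∂(waitingLaw.prod M) =
      ENNReal.ofReal ((1 - c)⁻¹ ^ n) := by
  rw [lintegral_prod _ (by fun_prop)]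
  simp only [lintegral_const, measure_univ, mul_one]
  rw [lintegral_exp_waitingLaw n (fun _ => c) (fun _ => hc) he]
  simp

lemma measure_first_wait_le {S : Type*} [MeasurableSpace S] {M : Measure (ℕ → S)}
    [IsProbabilityMeasure M] (a : ℝ) :
    (waitingLaw.prod M).real {ω : (ℕ → ℝ) × (ℕ → S) | a ≤ ω.1 0} ≤ 2 * Real.exp (-(a / 2)) := by
  have h := lintegral_fst_exp_le (M := M) 1 (c := 1 / 2) (by norm_num) Function.injective_id
  norm_num at h
  have := measure_le_of_lintegral_exp_le (Q := waitingLaw.prod M)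
    (X := fun ω : (ℕ → ℝ) × (ℕ → S) => ω.1 0) (t := 1 / 2) (B := 2) (by fun_prop) (by norm_num)
    (by norm_num) (by norm_num; exact h.le) a
  rwa [one_div_mul_eq_div] at this

/-- Tail bounds for the sum of the waiting times `ξ₁, …, ξ_N`: upwards for `s = 1`, downwards for
`s = -1`. -/
lemma measure_waits_le {S : Type*} [MeasurableSpace S] {M : Measure (ℕ → S)}
    [IsProbabilityMeasure M] (N : ℕ) {s θ : ℝ} (hs : |s| = 1) (hθ : 0 ≤ θ) (hθ' : θ ≤ 1 / 2)
    (a : ℝ) :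
    (waitingLaw.prod M).real {ω : (ℕ → ℝ) × (ℕ → S) | s * N + a ≤ ∑ k ∈ range N, s * ω.1 (k + 1)} ≤
      Real.exp (2 * θ ^ 2 * N - θ * a) := by
  have hs2 : s ^ 2 = 1 := by rw [← sq_abs, hs, one_pow]
  have habs : |θ * s| ≤ 1 / 2 := by rw [abs_mul, hs, mul_one, abs_of_nonneg hθ]; exact hθ'
  have hlt : θ * s < 1 := by linarith [(abs_le.1 habs).2]
  have h := lintegral_fst_exp_le (M := M) N hlt (e := fun k => k + 1) (add_left_injective 1)
  have hpow : (1 - θ * s)⁻¹ ^ N ≤ Real.exp (N * (θ * s + 2 * θ ^ 2)) := by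
    rw [Real.exp_nat_mul]
    refine pow_le_pow_left₀ (inv_nonneg.2 (by linarith)) ((inv_one_sub_le habs).trans ?_) N
    have := Real.add_one_le_exp (θ * s + 2 * θ ^ 2)
    rw [mul_pow, hs2]
    linarith
  have := measure_le_of_lintegral_exp_le (Q := waitingLaw.prod M)
    (X := fun ω : (ℕ → ℝ) × (ℕ → S) => ∑ k ∈ range N, s * ω.1 (k + 1)) (t := θ)
    (B := Real.exp (N * (θ * s + 2 * θ ^ 2))) (by fun_prop) hθ (Real.exp_pos _).le
    (by
      simp only [mul_sum, ← mul_assoc]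
      rw [h]
      exact ENNReal.ofReal_le_ofReal hpow) (s * N + a)
  refine this.trans_eq ?_
  rw [← Real.exp_add]
  congr 1
  ring

variable {S : Type*} [Fintype S] [MeasurableSpace S] [DiscreteMeasurableSpace S]
  [DecidableEq S] {P : Matrix S S ℝ} {ν π : S → ℝ} {M : Measure (ℕ → S)}

/-- Exponential moment of the sum of `ξ_{k+1} h(x_k)` over one residue class mod `L`. -/
lemma lintegral_exp_residue_le (hM : IsPathLaw P ν M) {L : ℕ} (hL : 0 < L) (r N : ℕ) {h : S → ℝ}
    {θ q : ℝ} (hh : ∀ x, |θ * h x| ≤ 1 / 2) (hq : 1 ≤ q)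
    (hrow : P ∈ Matrix.rowStochastic ℝ S)
    (hstep : ∀ x, ((P ^ L).mulVec fun y => (1 - θ * h y)⁻¹) x ≤ q) :
    ∫⁻ ω, ENNReal.ofReal (Real.exp (∑ l ∈ range (N / L + 1),
      if r + l * L < N then θ * (ω.1 (r + l * L + 1) * h (ω.2 (r + l * L))) else 0))
        ∂(waitingLaw.prod M) ≤ ENNReal.ofReal (2 * q ^ (N / L)) := by
  have := hM.isProb
  have hb : ∀ x, 1 / 2 ≤ 1 - θ * h x := fun x => by linarith [(abs_le.1 (hh x)).2]
  let φ : ℕ → S → ℝ := fun l y => (1 - if r + l * L < N then θ * h y else 0)⁻¹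
  have hφ : ∀ l y, 0 ≤ φ l y := fun l y => by
    simp only [φ]
    split_ifs
    · exact inv_nonneg.2 (by linarith [hb y])
    · norm_num
  have hdep : DependsOn (fun x : ℕ → S => ∏ l ∈ range (N / L + 1), φ l (x (r + l * L)))
      (Set.Iio (r + (N / L) * L + 1)) := by
    intro x y h
    refine prod_congr rfl fun l hl => ?_
    rw [h (r + l * L)]
    have : l * L ≤ N / L * L := Nat.mul_le_mul_right L (by simp at hl; omega)
    simp only [Set.mem_Iio]
    omega
  have hmeas : Measurable fun ω : (ℕ → ℝ) × (ℕ → S) => ENNReal.ofReal (Real.exp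
      (∑ l ∈ range (N / L + 1),
        if r + l * L < N then θ * (ω.1 (r + l * L + 1) * h (ω.2 (r + l * L))) else 0)) := by
    have hh : Measurable h := Measurable.of_discrete
    refine ENNReal.measurable_ofReal.comp (Real.measurable_exp.comp
      (Finset.measurable_fun_sum _ fun l _ => ?_))
    split_ifs <;> fun_prop
  rw [lintegral_prod_symm _ hmeas.aemeasurable]
  have hinner : ∀ x : ℕ → S, ∫⁻ ξ, ENNReal.ofReal (Real.exp (∑ l ∈ range (N / L + 1),
      if r + l * L < N then θ * (ξ (r + l * L + 1) * h (x (r + l * L))) else 0)) ∂waitingLaw =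
        ENNReal.ofReal (∏ l ∈ range (N / L + 1), φ l (x (r + l * L))) := by
    intro x
    have he : Function.Injective fun l : ℕ => r + l * L + 1 := by
      intro a b hab
      have : a * L = b * L := by simpa using hab
      exact Nat.eq_of_mul_eq_mul_right hL this
    have h1 := lintegral_exp_waitingLaw (N / L + 1)
      (fun l => if r + l * L < N then θ * h (x (r + l * L)) else 0)
      (fun l => by
        split_ifs
        · linarith [hb (x (r + l * L))]
        · norm_num) he
    rw [← h1]
    refine lintegral_congr fun ξ => ?_
    congr 2
    refine sum_congr rfl fun l _ => ?_
    split_ifs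
    · ring
    · simp
  simp only [hinner]
  rw [← ofReal_integral_eq_lintegral_ofReal (integrable_of_dependsOn hdep)
    (ae_of_all _ fun x => prod_nonneg fun l _ => hφ _ _)]
  refine ENNReal.ofReal_le_ofReal (integral_prod_le hM L r hφ (fun y => ?_) (by linarith)
    (fun l x => ?_) (N / L))
  · simp only [φ]
    split_ifs
    · rw [inv_le_comm₀ (by linarith [hb y]) (by norm_num)]
      linarith [hb y]
    · norm_num
  · by_cases hl : r + l * L < N
    · simpa only [φ, hl, if_true] using hstep x
    · simp only [φ, hl, if_false, sub_zero, inv_one]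
      simpa [Matrix.mulVec, dotProduct,
        Matrix.sum_row_of_mem_rowStochastic (pow_mem hrow L) x] using hq

/-- Tail bound for additive functionals weighted by the waiting times. Splitting into residue
classes mod `L` makes consecutive terms almost independent, at the price of the factor `1 / L` in
the exponent. -/
theorem measure_le_sum_le (hM : IsPathLaw P ν M) {L : ℕ} (hL : 0 < L) (N : ℕ) {h : S → ℝ}
    {θ q : ℝ} (hθ : 0 ≤ θ) (hh : ∀ x, |θ * h x| ≤ 1 / 2) (hq : 1 ≤ q)
    (hrow : P ∈ Matrix.rowStochastic ℝ S)
    (hstep : ∀ x, ((P ^ L).mulVec fun y => (1 - θ * h y)⁻¹) x ≤ q) (a : ℝ) :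
    (waitingLaw.prod M).real {ω | a ≤ ∑ k ∈ range N, ω.1 (k + 1) * h (ω.2 k)} ≤
      2 * q ^ (N / L) * Real.exp (-(θ / L * a)) := by
  have := hM.isProb
  have hhm : Measurable h := Measurable.of_discrete
  set X : (ℕ → ℝ) × (ℕ → S) → ℝ := fun ω => ∑ k ∈ range N, ω.1 (k + 1) * h (ω.2 k) with hX
  have hXm : Measurable X := by fun_prop
  have hint : ∫⁻ ω, ENNReal.ofReal (Real.exp (θ / L * X ω)) ∂(waitingLaw.prod M) ≤
      ENNReal.ofReal (2 * q ^ (N / L)) := by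
    calc _ ≤ ∫⁻ ω, ∑ r ∈ range L, ENNReal.ofReal (L : ℝ)⁻¹ * ENNReal.ofReal (Real.exp
          (∑ l ∈ range (N / L + 1),
            if r + l * L < N then θ * (ω.1 (r + l * L + 1) * h (ω.2 (r + l * L))) else 0))
            ∂(waitingLaw.prod M) := by
          refine lintegral_mono fun ω => ?_
          refine (ENNReal.ofReal_le_ofReal (exp_sum_le_residues
            (fun k => ω.1 (k + 1) * h (ω.2 k)) hL N θ)).trans_eq ?_
          rw [ENNReal.ofReal_sum_of_nonneg fun r _ => by positivity]
          exact sum_congr rfl fun r _ => ENNReal.ofReal_mul (by positivity)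
      _ = ∑ r ∈ range L, ENNReal.ofReal (L : ℝ)⁻¹ * ∫⁻ ω, ENNReal.ofReal (Real.exp
          (∑ l ∈ range (N / L + 1),
            if r + l * L < N then θ * (ω.1 (r + l * L + 1) * h (ω.2 (r + l * L))) else 0))
            ∂(waitingLaw.prod M) := by
          have hm : ∀ r, Measurable fun ω : (ℕ → ℝ) × (ℕ → S) => ENNReal.ofReal (Real.exp
              (∑ l ∈ range (N / L + 1), if r + l * L < N then
                θ * (ω.1 (r + l * L + 1) * h (ω.2 (r + l * L))) else 0)) := by
            intro r
            refine ENNReal.measurable_ofReal.comp (Real.measurable_exp.comp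
              (Finset.measurable_fun_sum _ fun l _ => ?_))
            split_ifs <;> fun_prop
          rw [lintegral_finsetSum _ fun r _ => (hm r).const_mul _]
          exact sum_congr rfl fun r _ => lintegral_const_mul _ (hm r)
      _ ≤ ∑ r ∈ range L, ENNReal.ofReal (L : ℝ)⁻¹ * ENNReal.ofReal (2 * q ^ (N / L)) :=
          sum_le_sum fun r _ => mul_le_mul_right
            (lintegral_exp_residue_le hM hL r N hh hq hrow hstep) _
      _ = _ := by
          rw [sum_const, card_range, nsmul_eq_mul, ← mul_assoc, ← ENNReal.ofReal_natCast,
            ← ENNReal.ofReal_mul (by positivity), mul_inv_cancel₀ (by positivity),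
            ENNReal.ofReal_one, one_mul]
  exact measure_le_of_lintegral_exp_le hXm (by positivity) (by positivity) hint a

end

/-! ### Concentration of the soft local times -/

section

section Static
variable {S : Type*} [Fintype S] {P : Matrix S S ℝ} {π μ : S → ℝ}

/-- The variance of the column `x ↦ p(x, z)`. -/
def columnVar (P : Matrix S S ℝ) (π : S → ℝ) (z : S) : ℝ := mean π fun x => (P x z - π z) ^ 2

lemma mean_column (hπP : Matrix.vecMul π P = π) (z : S) : mean π (fun x => P x z) = π z :=
  congrFun hπP z

lemma var_arrivalDensity (hπP : Matrix.vecMul π P = π) (z : S) :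
    var π (arrivalDensity P μ z) = columnVar P π z / μ z ^ 2 := by
  have h : mean π (arrivalDensity P μ z) = π z / μ z := by
    rw [← mean_column hπP z, mean, mean, sum_div]
    exact sum_congr rfl fun x _ => (mul_div_assoc _ _ _).symm
  rw [var, h, columnVar, mean, mean, sum_div]
  refine sum_congr rfl fun x _ => ?_
  rw [arrivalDensity]
  ring

lemma mean_column_sub (hπ : π ∈ stdSimplex ℝ S) (hπP : Matrix.vecMul π P = π) (z : S) :
    mean π (fun x => P x z - π z) = 0 := by
  have h := mean_column hπP z
  simp only [mean] at h ⊢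
  simp_rw [mul_sub]
  rw [sum_sub_distrib, h, ← sum_mul, hπ.2, one_mul, sub_self]

/-- Second-order bound on the mean of `1 / (1 - θ s h)` for the centred column `h`. -/
lemma mean_inv_one_sub_le (hπ : π ∈ stdSimplex ℝ S) (hπP : Matrix.vecMul π P = π) (z : S) {θ s : ℝ}
    (hs : |s| = 1) (h : ∀ x, |θ * (s * (P x z - π z))| ≤ 1 / 2) :
    mean π (fun x => (1 - θ * (s * (P x z - π z)))⁻¹) ≤ 1 + 2 * θ ^ 2 * columnVar P π z := by
  have hs2 : s ^ 2 = 1 := by rw [← sq_abs, hs, one_pow]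
  have h0 := mean_column_sub hπ hπP z
  simp only [columnVar, mean] at h0 ⊢
  calc _ ≤ ∑ x, π x * (1 + θ * (s * (P x z - π z)) + 2 * (θ * (s * (P x z - π z))) ^ 2) :=
        sum_le_sum fun x _ => mul_le_mul_of_nonneg_left (inv_one_sub_le (h x)) (hπ.1 x)
    _ = ∑ x, π x + θ * s * ∑ x, π x * (P x z - π z) +
          2 * θ ^ 2 * ∑ x, π x * (P x z - π z) ^ 2 := by
        rw [mul_sum, mul_sum, ← sum_add_distrib, ← sum_add_distrib]
        refine sum_congr rfl fun x _ => ?_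
        linear_combination (2 * π x * θ ^ 2 * (P x z - π z) ^ 2) * hs2
    _ = _ := by rw [h0, hπ.2]; ring

end Static

variable {S : Type*} [Fintype S] [MeasurableSpace S] [DiscreteMeasurableSpace S]
  [DecidableEq S] {P : Matrix S S ℝ} {ν π : S → ℝ} {M : Measure (ℕ → S)}

/-- Deviations of the additive functional of the centred column `x ↦ p(x, z) - π(z)`. The blocks
have length `4 ⌈k⌉ T`, so that the error of the law at the end of a block is negligible against
the variance term of the exponential moment. -/
lemma measure_column_le [Nonempty S] (hM : IsPathLaw P ν M) (hP : P ∈ Matrix.rowStochastic ℝ S)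
    (hπ : π ∈ stdSimplex ℝ S) (hpos : ∀ z, 0 < π z) (hπP : Matrix.vecMul π P = π) {T : ℕ}
    (hT : ∀ x, tvDist ((P ^ T) x) π ≤ 1 / 4) (hT0 : 0 < T) (z : S) {s ε b k : ℝ} (hs : |s| = 1)
    (hε : 0 < ε) (hPb : ∀ x, P x z ≤ b) (hπb : π z ≤ b)
    (hεb : ε * (2 * b * π z) ≤ columnVar P π z) (hk : 4 ≤ k)
    (hk2 : (2 : ℝ) ^ (-k) ≤ piMin π * ε ^ 2 * π z ^ 2 / (6 * columnVar P π z))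
    {N n : ℕ} (hN : N ≤ 2 * n) :
    (waitingLaw.prod M).real
      {ω | ε * n * π z / 8 ≤ ∑ k ∈ range N, ω.1 (k + 1) * (s * (P (ω.2 k) z - π z))} ≤
      2 * Real.exp (-(ε ^ 2 * π z ^ 2 / columnVar P π z * (n / (k * T)) / 16384)) := by
  set v := columnVar P π z with hv
  set p := π z with hp
  have hp0 : 0 < p := hpos z
  have hb0 : 0 < b := hp0.trans_le hπb
  have hv0 : 0 < v := lt_of_lt_of_le (by positivity) hεb
  have hm0 : 0 < piMin π := piMin_pos hpos
  set J := 4 * ⌈k⌉₊ with hJ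
  have hkpos : 0 < k := by linarith
  have hceil : 0 < ⌈k⌉₊ := Nat.ceil_pos.2 hkpos
  have hL : 0 < T * J := by positivity
  -- Up to constants, this `θ` minimizes the exponent `4 θ² v - θ ε p / 8` of the Chernoff bound.
  set θ := ε * p / (64 * v) with hθ
  have hθ0 : 0 < θ := by positivity
  set w := ε ^ 2 * p ^ 2 / v with hw
  have hw0 : 0 < w := by positivity
  have hθb : θ * b ≤ 1 / 2 := by
    rw [hθ, div_mul_eq_mul_div, div_le_iff₀ (by positivity)]
    linarith
  have hh : ∀ x, |θ * (s * (P x z - p))| ≤ 1 / 2 := by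
    intro x
    rw [abs_mul, abs_mul, hs, one_mul, abs_of_pos hθ0]
    refine le_trans (mul_le_mul_of_nonneg_left ?_ hθ0.le) hθb
    have := hP.1 x z
    exact abs_sub_le_of_nonneg_of_le this (hPb x) hp0.le hπb
  set δ := 2 * (1 / 2 : ℝ) ^ J / piMin π with hδ
  have hδ0 : 0 < δ := by positivity
  -- `(1/2) ^ J ≤ 2 ^ (-k) * 2 ^ (-3 k)`, and `2 ^ (-3 k) ≤ 2 ^ (-12)` since `k ≥ 4`.
  have hδw : δ ≤ w / 12288 := by
    have h1 : (1 / 2 : ℝ) ^ J ≤ (2 : ℝ) ^ (-k) * (1 / 4096) := by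
      have h3 : (1 / 2 : ℝ) ^ J = (2 : ℝ) ^ (-(J : ℝ)) := by
        rw [Real.rpow_neg (by norm_num), Real.rpow_natCast, one_div, inv_pow]
      have h4 : (1 / 4096 : ℝ) = (2 : ℝ) ^ (-(12 : ℝ)) := by
        rw [Real.rpow_neg (by norm_num)]
        norm_num
      rw [h3, h4, ← Real.rpow_add (by norm_num)]
      refine Real.rpow_le_rpow_of_exponent_le (by norm_num) ?_
      have := Nat.le_ceil k
      rw [hJ]
      push_cast
      linarith
    rw [hδ, div_le_iff₀ hm0]
    calc 2 * (1 / 2 : ℝ) ^ J ≤ 2 * (piMin π * ε ^ 2 * p ^ 2 / (6 * v) * (1 / 4096)) := by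
          linarith
      _ = w / 12288 * piMin π := by
          rw [hw]
          field_simp
          norm_num
  set q := (1 + δ) * (1 + 2 * θ ^ 2 * v) with hq
  have hq1 : 1 ≤ q := by
    rw [hq]
    have : 0 ≤ 2 * θ ^ 2 * v := by positivity
    nlinarith
  have hqexp : q ≤ Real.exp (δ + 2 * θ ^ 2 * v) := by
    rw [Real.exp_add]
    refine mul_le_mul ?_ ?_ (by positivity) (Real.exp_pos _).le
    · linarith [Real.add_one_le_exp δ]
    · linarith [Real.add_one_le_exp (2 * θ ^ 2 * v)]
  have hstep : ∀ x, ((P ^ (T * J)).mulVec fun y => (1 - θ * (s * (P y z - p)))⁻¹) x ≤ q := by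
    intro x
    refine (mulVec_pow_le hP hπ hpos hπP hT J (fun y => inv_nonneg.2 ?_) x).trans ?_
    · linarith [(abs_le.1 (hh y)).2]
    · exact mul_le_mul_of_nonneg_left (mean_inv_one_sub_le hπ hπP z hs hh) (by positivity)
  refine (measure_le_sum_le hM hL N hθ0.le hh hq1 hP hstep _).trans ?_
  rw [mul_assoc]
  refine mul_le_mul_of_nonneg_left ?_ (by norm_num)
  have hθv : θ ^ 2 * v = w / 4096 := by
    rw [hθ, hw]
    field_simp
    norm_num
  have hθε : θ * (ε * p) = w / 64 := by
    rw [hθ, hw]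
    field_simp
  set R : ℝ := n / ((T * J : ℕ) : ℝ) with hR
  have hR0 : 0 ≤ R := by positivity
  have hNL : ((N / (T * J) : ℕ) : ℝ) ≤ 2 * R := by
    refine Nat.cast_div_le.trans ?_
    rw [hR, ← mul_div_assoc]
    refine div_le_div_of_nonneg_right ?_ (by positivity)
    exact_mod_cast hN
  have hRk : n / (k * T) / 8 ≤ R := by
    rw [hR, div_div]
    refine div_le_div_of_nonneg_left (by positivity) (by positivity) ?_
    have := (Nat.ceil_lt_add_one hkpos.le).le
    have hT1 : (0 : ℝ) ≤ T := by positivity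
    rw [hJ]
    push_cast
    nlinarith
  calc q ^ (N / (T * J)) * Real.exp (-(θ / ((T * J : ℕ) : ℝ) * (ε * n * p / 8)))
      ≤ Real.exp (δ + 2 * θ ^ 2 * v) ^ (N / (T * J)) *
        Real.exp (-(θ / ((T * J : ℕ) : ℝ) * (ε * n * p / 8))) :=
        mul_le_mul_of_nonneg_right (pow_le_pow_left₀ (by positivity) hqexp _) (Real.exp_pos _).le
    _ = Real.exp ((N / (T * J) : ℕ) * (δ + 2 * θ ^ 2 * v) - R * (θ * (ε * p)) / 8) := by
        rw [← Real.exp_nat_mul, ← Real.exp_add, hR]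
        congr 1
        ring
    _ ≤ _ := by
        refine Real.exp_le_exp.2 ?_
        have h1 : δ + 2 * θ ^ 2 * v ≤ w / 12288 + w / 2048 := by
          rw [mul_assoc, hθv]
          linarith
        have h2 : ((N / (T * J) : ℕ) : ℝ) * (δ + 2 * θ ^ 2 * v) ≤
            2 * R * (w / 12288 + w / 2048) :=
          mul_le_mul hNL h1 (by positivity) (by positivity)
        rw [hθε]
        have h3 := mul_le_mul_of_nonneg_right hRk hw0.le
        have h4 : 0 ≤ R * w := by positivity
        have h5 : w * (n / (k * T)) / 16384 = n / (k * T) / 8 * w / 2048 := by ring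
        rw [h5]
        linarith

/-- Deviations of the soft local time at `z` from its stationary mean `m π(z)`. They come from the
first step, from the waiting times, or from the additive functional of the centred column. -/
lemma measure_softTime_le [Nonempty S] (hM : IsPathLaw P ν M) (hP : P ∈ Matrix.rowStochastic ℝ S)
    (hπ : π ∈ stdSimplex ℝ S) (hpos : ∀ z, 0 < π z) (hπP : Matrix.vecMul π P = π) {T : ℕ}
    (hT : ∀ x, tvDist ((P ^ T) x) π ≤ 1 / 4) (hT0 : 0 < T) (hν : ∀ z, 0 ≤ ν z)
    (z : S) {ε b k : ℝ}
    (hε : 0 < ε) (hε2 : ε ≤ 1 / 2) (hPb : ∀ x, P x z ≤ b) (hπb : π z ≤ b)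
    (hεb : ε * (2 * b * π z) ≤ columnVar P π z) (hk : 4 ≤ k)
    (hk2 : (2 : ℝ) ^ (-k) ≤ piMin π * ε ^ 2 * π z ^ 2 / (6 * columnVar P π z))
    {m n : ℕ} (hm : 0 < m) (hmn : m ≤ 2 * n) (hn : 16 ≤ n * ε) :
    (waitingLaw.prod M).real
      {ω | 3 / 8 * (ε * n * π z) ≤ |softTime P ν m ω z - m * π z|} ≤
      4 * (Real.exp (-(1 / 16384 * n * ε ^ 2)) + expNegRatio (1 / 16384 * n * ε) (π z) (ν z) +
        Real.exp (-(ε ^ 2 * π z ^ 2 / columnVar P π z * (n / (k * T)) / 16384))) := by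
  have := hM.isProb
  obtain ⟨N, rfl⟩ : ∃ N, m = N + 1 := ⟨m - 1, by omega⟩
  have hp0 := hpos z
  have hn0 : (0 : ℝ) < n := by
    by_contra h
    nlinarith
  set Q := waitingLaw.prod M with hQ
  set A : Set ((ℕ → ℝ) × (ℕ → S)) := {ω | ε * n * π z / 8 ≤ ν z * ω.1 0} with hA
  set B : ℝ → Set ((ℕ → ℝ) × (ℕ → S)) := fun s =>
    {ω | s * N + ε * n / 16 ≤ ∑ k ∈ range N, s * ω.1 (k + 1)} with hB
  set D : ℝ → Set ((ℕ → ℝ) × (ℕ → S)) := fun s =>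
    {ω | ε * n * π z / 8 ≤ ∑ k ∈ range N, ω.1 (k + 1) * (s * (P (ω.2 k) z - π z))} with hD
  have hsub : {ω | 3 / 8 * (ε * n * π z) ≤ |softTime P ν (N + 1) ω z - (N + 1 : ℕ) * π z|} ∩
      {ω | 0 < ω.1 0} ⊆ A ∪ B 1 ∪ B (-1) ∪ D 1 ∪ D (-1) := by
    rintro ω ⟨hω, hω0⟩
    by_contra hcon
    simp only [Set.mem_union, not_or] at hcon
    obtain ⟨⟨⟨⟨hA', hB1⟩, hB2⟩, hD1⟩, hD2⟩ := hcon
    simp only [A, B, D, Set.mem_ofPred_eq, not_le, ← mul_sum] at hω hω0 hA' hB1 hB2 hD1 hD2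
    have hdec : softTime P ν (N + 1) ω z - (N + 1 : ℕ) * π z = ν z * ω.1 0 +
        π z * ((∑ k ∈ range N, ω.1 (k + 1)) - N - 1) +
        ∑ k ∈ range N, ω.1 (k + 1) * (P (ω.2 k) z - π z) := by
      rw [softTime, sum_range_succ']
      simp only [stepProb, mul_sub, sum_sub_distrib, ← sum_mul]
      push_cast
      ring
    have hD3 : ∑ k ∈ range N, ω.1 (k + 1) * (-1 * (P (ω.2 k) z - π z)) =
        -∑ k ∈ range N, ω.1 (k + 1) * (P (ω.2 k) z - π z) := by
      rw [← sum_neg_distrib]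
      exact sum_congr rfl fun _ _ => by ring
    simp only [one_mul] at hD1 hB1
    rw [hD3] at hD2
    have hν0 : 0 ≤ ν z * ω.1 0 := mul_nonneg (hν z) hω0.le
    have h1 : π z * ((∑ k ∈ range N, ω.1 (k + 1)) - N - 1) ≤ π z * (ε * n / 16) :=
      mul_le_mul_of_nonneg_left (by linarith) hp0.le
    have h2 : π z * (-(ε * n / 8)) ≤ π z * ((∑ k ∈ range N, ω.1 (k + 1)) - N - 1) :=
      mul_le_mul_of_nonneg_left (by linarith) hp0.le
    rw [hdec] at hω
    have hεnp : 0 < ε * n * π z := by positivity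
    rcases le_abs.1 hω with h | h
    · nlinarith
    · nlinarith
  have hAle : Q.real A ≤ 2 * expNegRatio (1 / 16384 * n * ε) (π z) (ν z) := by
    rw [expNegRatio]
    split_ifs with h0
    · have : A = ∅ := by
        ext ω
        simp only [A, h0, zero_mul, Set.mem_ofPred_eq, Set.mem_empty_iff_false, iff_false, not_le]
        positivity
      simp [this]
    · have hν0 : 0 < ν z := lt_of_le_of_ne (hν z) (Ne.symm h0)
      have hAe : A = {ω | ε * n * π z / 8 / ν z ≤ ω.1 0} := by
        ext ω
        simp only [A, Set.mem_ofPred_eq]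
        rw [div_le_iff₀' hν0]
      rw [hAe]
      refine (measure_first_wait_le _).trans
        (mul_le_mul_of_nonneg_left (Real.exp_le_exp.2 (neg_le_neg ?_)) (by norm_num))
      have : 0 ≤ ε * n * (π z / ν z) := by positivity
      calc _ = ε * n * (π z / ν z) / 16384 := by ring
        _ ≤ ε * n * (π z / ν z) / 16 := by linarith
        _ = _ := by ring
  have hBle : ∀ s : ℝ, |s| = 1 → Q.real (B s) ≤ Real.exp (-(1 / 16384 * n * ε ^ 2)) := by
    intro s hs
    refine (measure_waits_le N hs (θ := ε / 128) (by positivity) (by linarith) _).trans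
      (Real.exp_le_exp.2 ?_)
    have hN : (N : ℝ) ≤ 2 * n := by
      have : N ≤ 2 * n := by omega
      exact_mod_cast this
    have hε0 : 0 < ε ^ 2 := by positivity
    have := mul_le_mul_of_nonneg_left hN hε0.le
    have h3 : 0 < ε ^ 2 * n := by positivity
    linarith
  have hDle : ∀ s : ℝ, |s| = 1 → Q.real (D s) ≤
      2 * Real.exp (-(ε ^ 2 * π z ^ 2 / columnVar P π z * (n / (k * T)) / 16384)) := fun s hs =>
    measure_column_le hM hP hπ hpos hπP hT hT0 z hs hε hPb hπb hεb hk hk2 (by omega)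
  have hfull : Q.real {ω | 3 / 8 * (ε * n * π z) ≤ |softTime P ν (N + 1) ω z - (N + 1 : ℕ) * π z|} ≤
      Q.real (A ∪ B 1 ∪ B (-1) ∪ D 1 ∪ D (-1)) := by
    have hξ : ∀ᵐ ω ∂Q, ω ∈ {ω : (ℕ → ℝ) × (ℕ → S) | 0 < ω.1 0} :=
      (Measure.quasiMeasurePreserving_fst.ae ae_pos_waitingLaw).mono fun ω h => h 0
    refine ENNReal.toReal_mono (measure_ne_top _ _) (measure_mono_ae ?_)
    filter_upwards [hξ] with ω h1 h2
    exact hsub ⟨h2, h1⟩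
  have hu : Q.real (A ∪ B 1 ∪ B (-1) ∪ D 1 ∪ D (-1)) ≤
      Q.real A + Q.real (B 1) + Q.real (B (-1)) + Q.real (D 1) + Q.real (D (-1)) := by
    refine (measureReal_union_le _ _).trans (add_le_add_left ?_ _)
    refine (measureReal_union_le _ _).trans (add_le_add_left ?_ _)
    refine (measureReal_union_le _ _).trans (add_le_add_left ?_ _)
    exact measureReal_union_le _ _
  have hexp0 : 0 ≤ expNegRatio (1 / 16384 * n * ε) (π z) (ν z) := by
    rw [expNegRatio]
    split_ifs
    exacts [le_rfl, (Real.exp_pos _).le]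
  have := hBle 1 (by norm_num)
  have := hBle (-1) (by norm_num)
  have := hDle 1 (by norm_num)
  have := hDle (-1) (by norm_num)
  have := Real.exp_pos (-(1 / 16384 * n * ε ^ 2))
  linarith

end

/-! ### Gluing two chains along their hitting levels -/

section

/-- Gluing: two random variables with the same law can be realized as one, by choosing the two
sample points independently from their conditional laws given the common value. -/
theorem exists_coupling_of_map_eq {Ω₁ Ω₂ E : Type*} [MeasurableSpace Ω₁] [StandardBorelSpace Ω₁]
    [MeasurableSpace Ω₂] [StandardBorelSpace Ω₂] [MeasurableSpace E] [MeasurableEq E]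
    {Q₁ : Measure Ω₁} {Q₂ : Measure Ω₂} [IsProbabilityMeasure Q₁] [IsProbabilityMeasure Q₂]
    {V₁ : Ω₁ → E} {V₂ : Ω₂ → E} (hV₁ : Measurable V₁) (hV₂ : Measurable V₂)
    (h : Q₁.map V₁ = Q₂.map V₂) :
    ∃ Q : Measure (Ω₁ × Ω₂), IsProbabilityMeasure Q ∧ Q.map Prod.fst = Q₁ ∧
      Q.map Prod.snd = Q₂ ∧ ∀ᵐ ω ∂Q, V₁ ω.1 = V₂ ω.2 := by
  have : Nonempty Ω₁ := nonempty_of_isProbabilityMeasure Q₁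
  have : Nonempty Ω₂ := nonempty_of_isProbabilityMeasure Q₂
  have hp := Measure.isProbabilityMeasure_map (μ := Q₁) hV₁.aemeasurable
  let κ₁ : Kernel E Ω₁ := condDistrib id V₁ Q₁
  let κ₂ : Kernel E Ω₂ := condDistrib id V₂ Q₂
  let G : Measure (E × Ω₁ × Ω₂) := (Q₁.map V₁) ⊗ₘ (κ₁ ×ₖ κ₂)
  have h1 : G.map (fun p => (p.1, p.2.1)) = Q₁.map fun ω => (V₁ ω, ω) := by
    have : (Q₁.map V₁) ⊗ₘ κ₁ = Q₁.map fun ω => (V₁ ω, ω) :=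
      compProd_map_condDistrib aemeasurable_id
    rw [← this, ← Kernel.fst_prod κ₁ κ₂, Kernel.fst_eq, Measure.compProd_map measurable_fst]
    rfl
  have h2 : G.map (fun p => (p.1, p.2.2)) = Q₂.map fun ω => (V₂ ω, ω) := by
    have : (Q₂.map V₂) ⊗ₘ κ₂ = Q₂.map fun ω => (V₂ ω, ω) :=
      compProd_map_condDistrib aemeasurable_id
    rw [← this, ← h, ← Kernel.snd_prod κ₁ κ₂, Kernel.snd_eq, Measure.compProd_map measurable_snd]
    rfl
  have e1 : ∀ᵐ p ∂G, p.1 = V₁ p.2.1 := by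
    have : ∀ᵐ q ∂(G.map fun p => (p.1, p.2.1)), q.1 = V₁ q.2 := by
      rw [h1, ae_map_iff (by fun_prop) (measurableSet_eq_fun (by fun_prop) (by fun_prop))]
      exact ae_of_all _ fun _ => rfl
    exact ae_of_ae_map (by fun_prop) this
  have e2 : ∀ᵐ p ∂G, p.1 = V₂ p.2.2 := by
    have : ∀ᵐ q ∂(G.map fun p => (p.1, p.2.2)), q.1 = V₂ q.2 := by
      rw [h2, ae_map_iff (by fun_prop) (measurableSet_eq_fun (by fun_prop) (by fun_prop))]
      exact ae_of_all _ fun _ => rfl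
    exact ae_of_ae_map (by fun_prop) this
  refine ⟨G.map Prod.snd, Measure.isProbabilityMeasure_map measurable_snd.aemeasurable, ?_, ?_, ?_⟩
  · have := congrArg (Measure.map Prod.snd) h1
    rw [Measure.map_map (by fun_prop) (by fun_prop), Measure.map_map (by fun_prop) (by fun_prop)]
      at this
    rw [Measure.map_map (by fun_prop) (by fun_prop)]
    exact this.trans Measure.map_id
  · have := congrArg (Measure.map Prod.snd) h2
    rw [Measure.map_map (by fun_prop) (by fun_prop), Measure.map_map (by fun_prop) (by fun_prop)]
      at this
    rw [Measure.map_map (by fun_prop) (by fun_prop)]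
    exact this.trans Measure.map_id
  · rw [ae_map_iff (by fun_prop) (measurableSet_eq_fun (by fun_prop) (by fun_prop))]
    filter_upwards [e1, e2] with p h1 h2
    rw [← h1, ← h2]

variable {S : Type*}

/-- Two chains with the same hitting levels have nested ranges as soon as their soft local times
are strictly nested at the times in question. -/
lemma exists_visit_of_softTime_lt {P P' : Matrix S S ℝ} {ν ν' : S → ℝ}
    {ω ω' : (ℕ → ℝ) × (ℕ → S)} {z : S}
    (hq : ∀ k, 0 ≤ stepProb P ν k ω.2 z) (hq' : ∀ k, 0 ≤ stepProb P' ν' k ω'.2 z)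
    (hξ : ∀ k, 0 < ω.1 k) (hξ' : ∀ k, 0 < ω'.1 k) (hvis' : ∃ j, ω'.2 j = z)
    (heq : hitLevel P ν ω z = hitLevel P' ν' ω' z) {m m' : ℕ}
    (hlt : softTime P ν m ω z < softTime P' ν' m' ω' z) (h : ∃ j < m, ω.2 j = z) :
    ∃ j < m', ω'.2 j = z := by
  obtain ⟨j, hj, hjz⟩ := h
  by_contra hcon
  push Not at hcon
  have h1 := hitLevel_le_softTime hq hξ hjz hj
  have h2 := softTime_le_hitLevel hq' hξ' hvis' hcon
  linarith

lemma mem_visited_iff {Ω : Type*} (Y : Ω → ℕ → S) (t : ℝ) (ω : Ω) (z : S) :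
    z ∈ visited (fun j ω => Y ω (j - 1)) t ω ↔ ∃ j < ⌊t⌋₊, Y ω j = z := by
  simp only [visited, Set.mem_ofPred_eq]
  constructor
  · rintro ⟨i, hi, hit, h⟩
    refine ⟨i - 1, ?_, h⟩
    have := Nat.le_floor hit
    omega
  · rintro ⟨j, hj, h⟩
    refine ⟨j + 1, by omega, ?_, h⟩
    have ht : 0 ≤ t := by
      by_contra ht
      simp [Nat.floor_of_nonpos (not_le.1 ht).le] at hj
    exact (Nat.le_floor_iff ht).1 hj

end

/-! ### The coupling -/

section

section Parameters
variable {S : Type*} [Fintype S] {P : Fin 2 → Matrix S S ℝ} {π μ : S → ℝ}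

/-- The hypotheses on `ε` and the definition of `k(ε)`, rewritten without the reference measure `μ`,
which cancels. Here `b` stands for `‖ρ_z‖_∞ μ(z)`. They force `k(ε) ≥ 4`. -/
lemma exists_column_bound (hP : ∀ i x z, 0 ≤ P i x z) (hπ : π ∈ stdSimplex ℝ S)
    (hpos : ∀ z, 0 < π z) (hπP : ∀ i, Matrix.vecMul π (P i) = π) (hμ : ∀ x, 0 < μ x) {ε : ℝ}
    (hε : 0 < ε) (hε2 : ε ≤ 1 / 2)
    (h : ∀ i z, ε ≤ var π (arrivalDensity (P i) μ z) /
      (2 * ‖arrivalDensity (P i) μ z‖ * statDensity π μ z)) (i : Fin 2) (z : S) :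
    ∃ b, (∀ x, P i x z ≤ b) ∧ π z ≤ b ∧ ε * (2 * b * π z) ≤ columnVar (P i) π z ∧
      4 ≤ kFun P π μ ε ∧ (2 : ℝ) ^ (-kFun P π μ ε) ≤
        piMin π * ε ^ 2 * π z ^ 2 / (6 * columnVar (P i) π z) := by
  have : Nonempty S := ⟨z⟩
  have hm0 : 0 < piMin π := piMin_pos hpos
  have key : ∀ i z, ∃ b, (∀ x, P i x z ≤ b) ∧ π z ≤ b ∧
      ε * (2 * b * π z) ≤ columnVar (P i) π z := by
    intro i z
    have hb : ∀ x, P i x z ≤ ‖arrivalDensity (P i) μ z‖ * μ z := by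
      intro x
      have := norm_le_pi_norm (arrivalDensity (P i) μ z) x
      rw [arrivalDensity, Real.norm_of_nonneg (div_nonneg (hP i x z) (hμ z).le)] at this
      exact (div_le_iff₀ (hμ z)).1 this
    have hπb : π z ≤ ‖arrivalDensity (P i) μ z‖ * μ z := by
      calc π z = mean π fun x => P i x z := (mean_column (hπP i) z).symm
        _ ≤ ∑ x, π x * (‖arrivalDensity (P i) μ z‖ * μ z) :=
          sum_le_sum fun x _ => mul_le_mul_of_nonneg_left (hb x) (hπ.1 x)
        _ = _ := by rw [← sum_mul, hπ.2, one_mul]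
    refine ⟨_, hb, hπb, ?_⟩
    have hn : 0 < ‖arrivalDensity (P i) μ z‖ :=
      pos_of_mul_pos_left ((hpos z).trans_le hπb) (hμ z).le
    have hg : 0 < statDensity π μ z := div_pos (hpos z) (hμ z)
    have h1 := h i z
    rw [le_div_iff₀ (by positivity), var_arrivalDensity (hπP i), statDensity,
      le_div_iff₀ (pow_pos (hμ z) 2)] at h1
    refine le_trans (le_of_eq ?_) h1
    have := (hμ z).ne'
    field_simp
  have harg : ∀ i z, piMin π * ε ^ 2 * statDensity π μ z ^ 2 /
      (6 * var π (arrivalDensity (P i) μ z)) =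
      piMin π * ε ^ 2 * π z ^ 2 / (6 * columnVar (P i) π z) := by
    intro i z
    have h1 := (hμ z).ne'
    rw [var_arrivalDensity (hπP i), statDensity, div_pow, ← mul_div_assoc, ← mul_div_assoc,
      div_div_div_cancel_right₀ (pow_ne_zero 2 h1)]
  have hargpos : ∀ i z, 0 < piMin π * ε ^ 2 * π z ^ 2 / (6 * columnVar (P i) π z) := by
    intro i z
    obtain ⟨b, -, hπb, hb⟩ := key i z
    have hp := hpos z
    have hb0 : 0 < b := hp.trans_le hπb
    have hv : 0 < columnVar (P i) π z := lt_of_lt_of_le (by positivity) hb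
    positivity
  have hkle : ∀ i z, -kFun P π μ ε ≤
      Real.logb 2 (piMin π * ε ^ 2 * π z ^ 2 / (6 * columnVar (P i) π z)) := by
    intro i z
    rw [kFun, neg_neg, ← harg]
    exact (ciInf_le (Set.finite_range _).bddBelow i).trans
      (ciInf_le (Set.finite_range _).bddBelow z)
  have hk4 : 4 ≤ kFun P π μ ε := by
    obtain ⟨b, -, hπb, hb⟩ := key i z
    have hp := hpos z
    have hb0 : 0 < b := hp.trans_le hπb
    have hv : 0 < columnVar (P i) π z := lt_of_lt_of_le (by positivity) hb
    have hm1 : piMin π ≤ 1 := (piMin_le π z).trans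
      (hπ.2 ▸ single_le_sum (fun y _ => hπ.1 y) (mem_univ z))
    have hle : piMin π * ε ^ 2 * π z ^ 2 / (6 * columnVar (P i) π z) ≤ (2 : ℝ) ^ (-4 : ℝ) := by
      have h16 : (2 : ℝ) ^ (-4 : ℝ) = 1 / 16 := by
        rw [Real.rpow_neg (by norm_num)]
        norm_num
      rw [h16, div_le_iff₀ (by positivity)]
      have h1 : π z ^ 2 ≤ b * π z := by nlinarith
      calc piMin π * ε ^ 2 * π z ^ 2 ≤ 1 * ε ^ 2 * (b * π z) := by gcongr
        _ = ε * (ε * (b * π z)) := by ring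
        _ ≤ 1 / 2 * (ε * (b * π z)) := mul_le_mul_of_nonneg_right hε2 (by positivity)
        _ ≤ _ := by linarith
    have := (hkle i z).trans ((Real.logb_le_iff_le_rpow (by norm_num) (hargpos i z)).2 hle)
    linarith
  obtain ⟨b, hb1, hb2, hb3⟩ := key i z
  refine ⟨b, hb1, hb2, hb3, hk4, ?_⟩
  calc (2 : ℝ) ^ (-kFun P π μ ε) ≤ _ :=
        Real.rpow_le_rpow_of_exponent_le (by norm_num) (hkle i z)
    _ = _ := Real.rpow_logb (by norm_num) (by norm_num) (hargpos i z)

end Parameters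

variable {S : Type*} [Fintype S] [MeasurableSpace S] [DiscreteMeasurableSpace S]

/-- A path read off from a sample point, with its time shifted to start at `1`, is a Markov chain
as soon as it has the path law of the chain. -/
lemma isMarkovChain_of_map_eq {P : Matrix S S ℝ} {ν : S → ℝ} {M : Measure (ℕ → S)}
    (hM : IsPathLaw P ν M) {Ω : Type*} [MeasurableSpace Ω] {Q : Measure Ω} {Y : Ω → ℕ → S}
    (hY : Measurable Y) (hmap : Q.map Y = M) : IsMarkovChain Q P ν fun j ω => Y ω (j - 1) := by
  refine ⟨fun i _ x => (measurable_pi_iff.1 hY (i - 1)) (measurableSet_singleton x),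
    fun m x => ?_⟩
  have hset : MeasurableSet {z : ℕ → S | ∀ j < m + 1, z j = x j} := by
    have : {z : ℕ → S | ∀ j < m + 1, z j = x j} =
        ⋂ j, ⋂ _ : j < m + 1, (fun z : ℕ → S => z j) ⁻¹' {x j} := by
      ext; simp
    rw [this]
    exact MeasurableSet.iInter fun j => MeasurableSet.iInter fun _ =>
      measurable_pi_apply j (measurableSet_singleton (x j))
  have h := hM.cylinder (m + 1) x
  rw [← hmap, measureReal_def, Measure.map_apply hY hset, prod_range_succ', mul_comm] at h
  rw [measureReal_def]
  refine Eq.trans ?_ h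
  congr 2
  ext ω
  simp

/-- The coupling, on a sample space in the universe of the state space. -/
theorem exists_range_coupling [DecidableEq S] {P : Fin 2 → Matrix S S ℝ} {π μ : S → ℝ}
    {ν : Fin 2 → S → ℝ}
    {T : Fin 2 → ℕ} (hP : ∀ i, P i ∈ Matrix.rowStochastic ℝ S) (hirr : ∀ i, (P i).IsIrreducible)
    (hπ : π ∈ stdSimplex ℝ S) (hπP : ∀ i, Matrix.vecMul π (P i) = π)
    (hT : ∀ i, IsMixingTime (P i) π (T i)) (hμ : ∀ x, 0 < μ x)
    (hν : ∀ i, ν i ∈ stdSimplex ℝ S) :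
    ∃ (Q : Measure (((ℕ → ℝ) × (ℕ → S)) × ((ℕ → ℝ) × (ℕ → S))))
      (Z : Fin 2 → ℕ → ((ℕ → ℝ) × (ℕ → S)) × ((ℕ → ℝ) × (ℕ → S)) → S),
      IsProbabilityMeasure Q ∧ (∀ i, IsMarkovChain Q (P i) (ν i) (Z i)) ∧
      ∀ (ε : ℝ) (n : ℕ), 0 < ε → ε ≤ 1 / 2 →
        (∀ i z, ε ≤ var π (arrivalDensity (P i) μ z) /
          (2 * ‖arrivalDensity (P i) μ z‖ * statDensity π μ z)) →
        Q.real (goodEvent Z n ε)ᶜ ≤ 8 * ∑ i, ∑ z,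
          (Real.exp (-(1 / 16384 * n * ε ^ 2)) +
            expNegRatio (1 / 16384 * n * ε) (π z) (ν i z) +
            Real.exp (-(1 / 16384 * ε ^ 2 * statDensity π μ z ^ 2 /
              var π (arrivalDensity (P i) μ z) * (n / (kFun P π μ ε * T i))))) := by
  have hpos : ∀ z, 0 < π z := invariant_pos (hirr 0) hπ (hπP 0)
  have hne : Nonempty S := by
    by_contra h
    have := not_nonempty_iff.1 h
    simpa using hπ.2
  choose M hM using fun i => exists_isPathLaw (hP i) (hν i)
  have hprob := fun i => (hM i).isProb
  have hTm : ∀ i x, tvDist ((P i ^ T i) x) π ≤ 1 / 4 := fun i => (hT i).1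
  have hq : ∀ i k x, stepProb (P i) (ν i) k x ∈ stdSimplex ℝ S := fun i =>
    stepProb_mem_stdSimplex (hP i) (hν i)
  have hvis := fun i => ae_forall_visited (hM i) (hP i) hπ hpos (hπP i) (hTm i)
  obtain ⟨Q, hQ, hfst, hsnd, hlev⟩ := exists_coupling_of_map_eq
    (measurable_hitLevel (P 0) (ν 0)) (measurable_hitLevel (P 1) (ν 1))
    (map_hitLevel_eq (hM 0) (hq 0) (hvis 0) (hM 1) (hq 1) (hvis 1))
  refine ⟨Q, ![fun j ω => ω.1.2 (j - 1), fun j ω => ω.2.2 (j - 1)], hQ, ?_, ?_⟩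
  · rw [Fin.forall_fin_two]
    constructor
    · refine isMarkovChain_of_map_eq (hM 0)
        (Y := fun ω : ((ℕ → ℝ) × (ℕ → S)) × ((ℕ → ℝ) × (ℕ → S)) => ω.1.2) (by fun_prop) ?_
      have := congrArg (Measure.map Prod.snd) hfst
      rw [Measure.map_map (by fun_prop) (by fun_prop)] at this
      exact this.trans (by simp)
    · refine isMarkovChain_of_map_eq (hM 1)
        (Y := fun ω : ((ℕ → ℝ) × (ℕ → S)) × ((ℕ → ℝ) × (ℕ → S)) => ω.2.2) (by fun_prop) ?_
      have := congrArg (Measure.map Prod.snd) hsnd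
      rw [Measure.map_map (by fun_prop) (by fun_prop)] at this
      exact this.trans (by simp)
  intro ε n hε hε2 hcond
  set G := goodEvent ![fun j (ω : ((ℕ → ℝ) × (ℕ → S)) × ((ℕ → ℝ) × (ℕ → S))) => ω.1.2 (j - 1),
    fun j ω => ω.2.2 (j - 1)] n ε with hG
  set F : Fin 2 → S → ℝ := fun i z => Real.exp (-(1 / 16384 * n * ε ^ 2)) +
    expNegRatio (1 / 16384 * n * ε) (π z) (ν i z) +
    Real.exp (-(1 / 16384 * ε ^ 2 * statDensity π μ z ^ 2 /
      var π (arrivalDensity (P i) μ z) * (n / (kFun P π μ ε * T i)))) with hF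
  have hexp0 : ∀ i z, 0 ≤ expNegRatio (1 / 16384 * n * ε) (π z) (ν i z) := by
    intro i z
    rw [expNegRatio]
    split_ifs
    exacts [le_rfl, (Real.exp_pos _).le]
  have hF0 : ∀ i z, 0 ≤ F i z := fun i z =>
    add_nonneg (add_nonneg (Real.exp_pos _).le (hexp0 i z)) (Real.exp_pos _).le
  have hle : ∀ i z, F i z ≤ ∑ i, ∑ z, F i z := fun i z =>
    (single_le_sum (fun z _ => hF0 i z) (mem_univ z)).trans
      (single_le_sum (f := fun i => ∑ z, F i z) (fun i _ => sum_nonneg fun z _ => hF0 i z)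
        (mem_univ i))
  obtain ⟨z₀⟩ := hne
  have htriv : ∀ i, 1 / 8 ≤ F i z₀ → Q.real Gᶜ ≤ 8 * ∑ i, ∑ z, F i z := fun i h => by
    have := hle i z₀
    have : Q.real Gᶜ ≤ 1 := measureReal_le_one
    linarith
  -- For a vanishing mixing time the last exponential is `1`, since `n / (k * 0) = 0`.
  by_cases hT0 : ∃ i, T i = 0
  · obtain ⟨i, hi⟩ := hT0
    refine htriv i ?_
    have := Real.exp_pos (-(1 / 16384 * n * ε ^ 2))
    have := hexp0 i z₀
    simp only [F, hi, Nat.cast_zero, mul_zero, div_zero, neg_zero, Real.exp_zero]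
    linarith
  push Not at hT0
  -- For small `n ε` the bound exceeds `1`.
  rcases lt_or_ge (n * ε) 16 with hn | hn
  · refine htriv 0 ?_
    have h1 := Real.add_one_le_exp (-(1 / 16384 * n * ε ^ 2))
    have h2 : (n : ℝ) * ε * ε ≤ 16 * (1 / 2) :=
      mul_le_mul hn.le hε2 hε.le (by norm_num)
    have := hexp0 0 z₀
    have := Real.exp_pos (-(1 / 16384 * ε ^ 2 * statDensity π μ z₀ ^ 2 /
      var π (arrivalDensity (P 0) μ z₀) * (n / (kFun P π μ ε * T 0))))
    simp only [F]
    nlinarith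
  have hn0 : (0 : ℝ) < n := by
    by_contra h
    nlinarith
  have hn32 : (32 : ℝ) ≤ n := by nlinarith
  -- The deviation event of the soft local time at `z` after `m` steps.
  let D : Fin 2 → ℕ → S → Set ((ℕ → ℝ) × (ℕ → S)) := fun i m z =>
    {ω | 3 / 8 * (ε * n * π z) ≤ |softTime (P i) (ν i) m ω z - m * π z|}
  have hDm : ∀ i m z, MeasurableSet (D i m z) := fun i m z =>
    measurableSet_le measurable_const
      (((measurable_softTime (P i) (ν i) m z).sub_const _).abs)
  have hD : ∀ i m z, 0 < m → m ≤ 2 * n → (waitingLaw.prod (M i)).real (D i m z) ≤ 4 * F i z := by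
    intro i m z hm hmn
    obtain ⟨b, hb1, hb2, hb3, hk, hk2⟩ :=
      exists_column_bound (fun i => (hP i).1) hπ hpos hπP hμ hε hε2 hcond i z
    have : Nonempty S := ⟨z⟩
    refine (measure_softTime_le (hM i) (hP i) hπ hpos (hπP i) (hTm i)
      (Nat.pos_of_ne_zero (hT0 i)) (hν i).1 z hε hε2 hb1 hb2 hb3 hk hk2 hm hmn hn).trans_eq ?_
    have hμz := (hμ z).ne'
    have hv : statDensity π μ z ^ 2 / var π (arrivalDensity (P i) μ z) =
        π z ^ 2 / columnVar (P i) π z := by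
      rw [var_arrivalDensity (hπP i), statDensity, div_pow,
        div_div_div_cancel_right₀ (pow_ne_zero 2 hμz)]
    have harg : ε ^ 2 * π z ^ 2 / columnVar (P i) π z * (n / (kFun P π μ ε * T i)) / 16384 =
        1 / 16384 * ε ^ 2 * statDensity π μ z ^ 2 / var π (arrivalDensity (P i) μ z) *
          (n / (kFun P π μ ε * T i)) := by
      rw [mul_div_assoc _ (statDensity π μ z ^ 2), hv]
      ring
    simp only [F, harg]
  set m₁ := ⌊(n : ℝ) * (1 - ε)⌋₊ with hm₁
  set m₂ := ⌊(n : ℝ) * (1 + ε)⌋₊ with hm₂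
  have hm₁le : (m₁ : ℝ) ≤ n * (1 - ε) := Nat.floor_le (by nlinarith)
  have hm₁pos : 0 < m₁ := Nat.floor_pos.2 (by nlinarith)
  have hm₂le : (m₂ : ℝ) ≤ n * (1 + ε) := Nat.floor_le (by positivity)
  have hm₂lt : (n : ℝ) * (1 + ε) < m₂ + 1 := Nat.lt_floor_add_one _
  have hm₂pos : 0 < m₂ := Nat.floor_pos.2 (by nlinarith)
  have hm₁n : m₁ ≤ 2 * n := by
    have : (m₁ : ℝ) ≤ (2 * n : ℕ) := by push_cast; nlinarith
    exact_mod_cast this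
  have hm₂n : m₂ ≤ 2 * n := by
    have : (m₂ : ℝ) ≤ (2 * n : ℕ) := by push_cast; nlinarith
    exact_mod_cast this
  have hnpos : 0 < n := by exact_mod_cast hn0
  have hξ : ∀ᵐ ω ∂Q, (∀ k, 0 < ω.1.1 k) ∧ ∀ k, 0 < ω.2.1 k := by
    refine Filter.Eventually.and ?_ ?_
    · have : ∀ᵐ ω ∂(Q.map Prod.fst), ∀ k, 0 < ω.1 k := by
        rw [hfst]
        exact Measure.quasiMeasurePreserving_fst.ae ae_pos_waitingLaw
      exact ae_of_ae_map (by fun_prop) this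
    · have : ∀ᵐ ω ∂(Q.map Prod.snd), ∀ k, 0 < ω.1 k := by
        rw [hsnd]
        exact Measure.quasiMeasurePreserving_fst.ae ae_pos_waitingLaw
      exact ae_of_ae_map (by fun_prop) this
  have hv : ∀ᵐ ω ∂Q, (∀ z, ∃ j, ω.1.2 j = z) ∧ ∀ z, ∃ j, ω.2.2 j = z := by
    refine Filter.Eventually.and ?_ ?_
    · have : ∀ᵐ ω ∂(Q.map Prod.fst), ∀ z, ∃ j, ω.2 j = z := by
        rw [hfst]
        exact Measure.quasiMeasurePreserving_snd.ae (hvis 0)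
      exact ae_of_ae_map (by fun_prop) this
    · have : ∀ᵐ ω ∂(Q.map Prod.snd), ∀ z, ∃ j, ω.2 j = z := by
        rw [hsnd]
        exact Measure.quasiMeasurePreserving_snd.ae (hvis 1)
      exact ae_of_ae_map (by fun_prop) this
  have hsub : Q.real Gᶜ ≤ Q.real (⋃ z ∈ (univ : Finset S), (Prod.fst ⁻¹' D 0 m₁ z ∪
      Prod.fst ⁻¹' D 0 m₂ z ∪ Prod.snd ⁻¹' D 1 n z)) := by
    refine ENNReal.toReal_mono (measure_ne_top _ _) (measure_mono_ae ?_)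
    filter_upwards [hξ, hv, hlev] with ω hω1 hω2 hω3 hbad
    by_contra hcon
    refine hbad ?_
    replace hcon : ω ∉ ⋃ z ∈ (univ : Finset S), (Prod.fst ⁻¹' D 0 m₁ z ∪
      Prod.fst ⁻¹' D 0 m₂ z ∪ Prod.snd ⁻¹' D 1 n z) := hcon
    simp only [D, Set.mem_iUnion, Set.mem_union, Set.mem_preimage, Set.mem_ofPred_eq, not_exists,
      not_or, not_le, mem_univ, true_implies] at hcon
    have hq0 : ∀ z k, 0 ≤ stepProb (P 0) (ν 0) k ω.1.2 z := fun z k => (hq 0 k _).1 z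
    have hq1 : ∀ z k, 0 ≤ stepProb (P 1) (ν 1) k ω.2.2 z := fun z k => (hq 1 k _).1 z
    have hfl : ⌊(n : ℝ)⌋₊ = n := Nat.floor_natCast n
    refine ⟨fun z hz => ?_, fun z hz => ?_⟩
    · obtain ⟨⟨h1, h2⟩, h3⟩ := hcon z
      have h1' := abs_lt.1 h1
      have h3' := abs_lt.1 h3
      have hz' := (mem_visited_iff
        (fun ω : ((ℕ → ℝ) × (ℕ → S)) × ((ℕ → ℝ) × (ℕ → S)) => ω.1.2) _ ω z).1 hz
      refine (mem_visited_iff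
        (fun ω : ((ℕ → ℝ) × (ℕ → S)) × ((ℕ → ℝ) × (ℕ → S)) => ω.2.2) _ ω z).2 ?_
      rw [hfl]
      refine exists_visit_of_softTime_lt (hq0 z) (hq1 z) hω1.1 hω1.2 (hω2.2 z)
        (congrFun hω3 z) ?_ hz'
      have := mul_le_mul_of_nonneg_right hm₁le (hpos z).le
      have : 0 < ε * n * π z := by have := hpos z; positivity
      nlinarith
    · obtain ⟨⟨h1, h2⟩, h3⟩ := hcon z
      have h2' := abs_lt.1 h2
      have h3' := abs_lt.1 h3
      have hz' := (mem_visited_iff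
        (fun ω : ((ℕ → ℝ) × (ℕ → S)) × ((ℕ → ℝ) × (ℕ → S)) => ω.2.2) _ ω z).1 hz
      refine (mem_visited_iff
        (fun ω : ((ℕ → ℝ) × (ℕ → S)) × ((ℕ → ℝ) × (ℕ → S)) => ω.1.2) _ ω z).2 ?_
      rw [hfl] at hz'
      refine exists_visit_of_softTime_lt (hq1 z) (hq0 z) hω1.2 hω1.1 (hω2.1 z)
        (congrFun hω3 z).symm ?_ hz'
      -- The rounding error `1` is absorbed by `n ε / 4`.
      have h4 := mul_le_mul_of_nonneg_right hm₂lt.le (hpos z).le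
      have h5 := mul_le_mul_of_nonneg_right hn (hpos z).le
      nlinarith
  refine hsub.trans ((measureReal_biUnion_finset_le _ _).trans ?_)
  have hQ1 : ∀ m z, Q.real (Prod.fst ⁻¹' D 0 m z) = (waitingLaw.prod (M 0)).real (D 0 m z) := by
    intro m z
    rw [← hfst, measureReal_def, measureReal_def, Measure.map_apply measurable_fst (hDm 0 m z)]
  have hQ2 : ∀ m z, Q.real (Prod.snd ⁻¹' D 1 m z) = (waitingLaw.prod (M 1)).real (D 1 m z) := by
    intro m z
    rw [← hsnd, measureReal_def, measureReal_def, Measure.map_apply measurable_snd (hDm 1 m z)]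
  rw [Fin.sum_univ_two, ← sum_add_distrib, mul_sum]
  refine sum_le_sum fun z _ => ?_
  refine (measureReal_union_le _ _).trans ?_
  have h1 := measureReal_union_le (μ := Q) (Prod.fst ⁻¹' D 0 m₁ z) (Prod.fst ⁻¹' D 0 m₂ z)
  rw [hQ1, hQ1] at h1
  rw [hQ2]
  have h2 := hD 0 m₁ z hm₁pos hm₁n
  have h3 := hD 0 m₂ z hm₂pos hm₂n
  have h4 := hD 1 n z hnpos (by omega)
  have h5 := hF0 1 z
  linarith

end

end RangeCoupling

theorem theorem3p2 :
    ∃ c C : ℝ, 0 < c ∧ 0 < C ∧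
      ∀ (S : Type*) [Fintype S] [DecidableEq S]
        (P : Fin 2 → Matrix S S ℝ) (π μ : S → ℝ) (ν : Fin 2 → S → ℝ) (T : Fin 2 → ℕ),
        (∀ i, P i ∈ Matrix.rowStochastic ℝ S) →
        (∀ i, (P i).IsIrreducible) →
        π ∈ stdSimplex ℝ S →
        (∀ i, Matrix.vecMul π (P i) = π) →
        (∀ i, RangeCoupling.IsMixingTime (P i) π (T i)) →
        (∀ x, 0 < μ x) →
        (∀ i, ν i ∈ stdSimplex ℝ S) →
        ∃ (Ω : Type) (_ : MeasurableSpace Ω) (Q : MeasureTheory.Measure Ω)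
          (Z : Fin 2 → ℕ → Ω → S),
          MeasureTheory.IsProbabilityMeasure Q ∧
          (∀ i, RangeCoupling.IsMarkovChain Q (P i) (ν i) (Z i)) ∧
          ∀ (ε : ℝ) (n : ℕ),
            0 < ε → ε ≤ 1 / 2 →
            (∀ i z, ε ≤ RangeCoupling.var π (RangeCoupling.arrivalDensity (P i) μ z) /
              (2 * ‖RangeCoupling.arrivalDensity (P i) μ z‖ *
                RangeCoupling.statDensity π μ z)) →
            2 * RangeCoupling.kFun P π μ ε * (max (T 0) (T 1) : ℕ) ≤ n →
            Q.real (RangeCoupling.goodEvent Z n ε)ᶜ ≤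
              C * ∑ i, ∑ z,
                (Real.exp (-(c * n * ε ^ 2)) +
                  RangeCoupling.expNegRatio (c * n * ε) (π z) (ν i z) +
                  Real.exp (-(c * ε ^ 2 * RangeCoupling.statDensity π μ z ^ 2 /
                    RangeCoupling.var π (RangeCoupling.arrivalDensity (P i) μ z) *
                    (n / (RangeCoupling.kFun P π μ ε * T i))))) := by

  refine ⟨1 / 16384, 8, by norm_num, by norm_num, ?_⟩
  intro S _ _ P π μ ν T hP hirr hπ hπP hT hμ hν
  let _ : MeasurableSpace S := ⊤
  have : DiscreteMeasurableSpace S := ⟨fun _ => trivial⟩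
  obtain ⟨Q, Z, hQ, hZ, hbound⟩ := RangeCoupling.exists_range_coupling hP hirr hπ hπP hT hμ hν
  -- A standard Borel space is isomorphic to a subset of `ℝ`, which lives in the lowest universe.
  obtain ⟨s, -, ⟨e⟩⟩ := MeasureTheory.exists_subset_real_measurableEquiv
    (((ℕ → ℝ) × (ℕ → S)) × ((ℕ → ℝ) × (ℕ → S)))
  have hreal : ∀ A : Set s, (Q.map e).real A = Q.real (e ⁻¹' A) := fun A => by
    rw [measureReal_def, measureReal_def, e.map_apply]
  refine ⟨s, inferInstance, Q.map e, fun i j ω => Z i j (e.symm ω),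
    Measure.isProbabilityMeasure_map e.measurable.aemeasurable, fun i => ⟨?_, ?_⟩, ?_⟩
  · intro j hj x
    exact e.symm.measurable ((hZ i).measurableSet_eq j hj x)
  · intro m x
    rw [hreal, ← (hZ i).law m x]
    congr 1
    ext ω
    simp
  · intro ε n hε hε2 hcond _
    refine le_trans (le_of_eq ?_) (hbound ε n hε hε2 hcond)
    rw [hreal]
    congr 1
    ext ω
    simp [RangeCoupling.goodEvent, RangeCoupling.visited]
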